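/- The following are theorems of ZF (Zermelo–Fraenkel set theory without the axiom of choice); that is, they hold in every model of ZF. Definitions. $[\omega_1]^{\omega}$ is the set of all subsets of $\omega_1$ of cardinality $\omega$, and $[A]^{<\omega}$ is the set of all finite subsets of $A$. A family $\mathcal A$ of sets is $n$-almost disjoint if $|A\cap B|<n$ for all distinct $A,B\in\mathcal A$. It is essentially disjoint if there is a function $f$ with domain $\mathcal A$ such that $f(A)\in[A]^{<\omega}$ for each $A\in\mathcal A$ and the sets $A\setminus f(A)$ $(A\in\mathcal A)$ are pairwise disjoint. $M(\omega_1,\omega,n)\to ED$ is the assertion that every $n$-almost disjoint family $\mathcal A\subseteq[\omega_1]^{\omega}$ is essentially disjoint. $UD(\omega_1)$ is the assertion that there is a function $f$ with domain $\omega_1$ such that $f(\alpha)$ is a function from $\omega$ onto $\alpha$ for every $1\le\alpha<\omega_1$. $cf(\omega_1)$ is the least ordinal $\beta$ for which there is a function from $\beta$ to $\omega_1$ with cofinal range. Theorem (ZF). (1) If $UD(\omega_1)$ holds, then $M(\omega_1,\omega,n)\to ED$ holds for every natural number $n\in\omega$. (2) If $M(\omega_1,\omega,2)\to ED$ holds,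 then $cf(\omega_1)=\omega_1$. -/

import Mathlib

/-!
The result is a theorem of `ZF`, that is, of set theory without the axiom of choice.  It is stated
as a fact about an arbitrary model `M` of the first-order theory `ZF`: a type `M` with a binary
relation `∈` (which need be neither well-founded nor standard).  Every notion below quantifies over
elements of `M` only and is built from `∈` and `=` by the first-order connectives, so it is the
interpretation in `M` of the corresponding formula of set theory.
-/

namespace ZFModel

universe u

/-- The only non-logical symbol of the language of set theory: one binary relation symbol. -/
inductive SetRel : ℕ → Type
  | mem : SetRel 2

/-- The first-order language of set theory. -/
def setLang : FirstOrder.Language.{0, 0} := ⟨fun _ => Empty, SetRel⟩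

/-- A type with a relation `∈` is a structure for the language of set theory. -/
instance setStructure (M : Type u) [Membership M M] : setLang.Structure M where
  funMap := fun f _ => Empty.elim f
  RelMap := fun r => match r with
    | SetRel.mem => fun v => v 0 ∈ v 1

/-- The symbol `∈`, as a relation symbol of the language. -/
def memSymb : setLang.Relations 2 := SetRel.mem

theorem relMap_memSymb {M : Type u} [Membership M M] (v : Fin 2 → M) :
    FirstOrder.Language.Structure.RelMap memSymb v ↔ v 0 ∈ v 1 := Iff.rfl

section Basic

variable {M : Type u} [Membership M M]

/-- `x` is empty. -/
def IsEmptySet (x : M) : Prop := ∀ z : M, ¬ z ∈ x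

/-- `x ⊆ y`. -/
def IsSubset (x y : M) : Prop := ∀ z : M, z ∈ x → z ∈ y

/-- `p = {a, b}`. -/
def IsUPair (a b p : M) : Prop := ∀ z : M, z ∈ p ↔ z = a ∨ z = b

/-- `y = x ∪ {x}`. -/
def IsSucc (x y : M) : Prop := ∀ z : M, z ∈ y ↔ z ∈ x ∨ z = x

/-- `c = a ∩ b`. -/
def IsInter (a b c : M) : Prop := ∀ z : M, z ∈ c ↔ z ∈ a ∧ z ∈ b

end Basic

/-- `(M, ∈)` is a model of `ZF`.  In the two schemata `φ` ranges over the first-order formulas of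
the language of set theory whose free variables are arbitrary parameters from `M` and the displayed
variables. -/
structure ModelsZF (M : Type u) [Membership M M] : Prop where
  extensionality : ∀ x y : M, (∀ z : M, z ∈ x ↔ z ∈ y) → x = y
  foundation : ∀ x : M, (∃ y : M, y ∈ x) → ∃ y : M, y ∈ x ∧ ∀ z : M, z ∈ x → ¬ z ∈ y
  pairing : ∀ a b : M, ∃ p : M, IsUPair a b p
  union : ∀ x : M, ∃ y : M, ∀ z : M, z ∈ y ↔ ∃ w : M, w ∈ x ∧ z ∈ w
  powerset : ∀ x : M, ∃ y : M, ∀ z : M, z ∈ y ↔ IsSubset z x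
  infinity : ∃ x : M, (∃ z : M, IsEmptySet z ∧ z ∈ x) ∧
    ∀ z : M, z ∈ x → ∃ s : M, IsSucc z s ∧ s ∈ x
  separation : ∀ (φ : setLang.Formula (M ⊕ Fin 1)) (a : M), ∃ b : M, ∀ x : M,
    x ∈ b ↔ x ∈ a ∧ φ.Realize (Sum.elim id ![x])
  replacement : ∀ (φ : setLang.Formula (M ⊕ Fin 2)) (a : M),
    (∀ x : M, x ∈ a → ∀ y z : M, φ.Realize (Sum.elim id ![x, y]) →
      φ.Realize (Sum.elim id ![x, z]) → y = z) →
    ∃ b : M, ∀ y : M, y ∈ b ↔ ∃ x : M, x ∈ a ∧ φ.Realize (Sum.elim id ![x, y])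

section Notions

variable {M : Type u} [Membership M M]

/-- `p` is the ordered pair `(a, b) = {{a}, {a, b}}`. -/
def IsOPair (a b p : M) : Prop :=
  ∃ s t : M, IsUPair a a s ∧ IsUPair a b t ∧ IsUPair s t p

/-- `(x, y) ∈ f`; for a function `f` this says `f(x) = y`. -/
def App (f x y : M) : Prop := ∃ p : M, p ∈ f ∧ IsOPair x y p

/-- `f` is a function with domain `X`. -/
def IsFunOn (f X : M) : Prop :=
  (∀ p : M, p ∈ f → ∃ x y : M, x ∈ X ∧ IsOPair x y p) ∧
  ∀ x : M, x ∈ X → ∃! y : M, App f x y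

/-- `f` is a function from `X` to `Y`. -/
def IsFun (f X Y : M) : Prop :=
  IsFunOn f X ∧ ∀ x y : M, App f x y → y ∈ Y

/-- `f` is a function from `X` onto `Y`. -/
def IsOnto (f X Y : M) : Prop :=
  IsFun f X Y ∧ ∀ y : M, y ∈ Y → ∃ x : M, App f x y

/-- `f` is a bijection from `X` to `Y`. -/
def IsBij (f X Y : M) : Prop :=
  IsOnto f X Y ∧ ∀ x x' y : M, App f x y → App f x' y → x = x'

/-- `|X| = |Y|`. -/
def Equinum (X Y : M) : Prop := ∃ f : M, IsBij f X Y

/-- `x` is an ordinal: a transitive set linearly ordered by `∈` (well-ordered, by foundation). -/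
def IsOrd (x : M) : Prop :=
  (∀ y : M, y ∈ x → IsSubset y x) ∧
  ∀ y z : M, y ∈ x → z ∈ x → y ∈ z ∨ y = z ∨ z ∈ y

/-- `x` is a nonzero limit ordinal. -/
def IsLimitOrd (x : M) : Prop :=
  IsOrd x ∧ (∃ y : M, y ∈ x) ∧ ∀ y : M, y ∈ x → ∃ z : M, z ∈ x ∧ y ∈ z

/-- `o = ω`, the least nonzero limit ordinal. -/
def IsOmega (o : M) : Prop :=
  IsLimitOrd o ∧ ∀ x : M, x ∈ o → ¬ IsLimitOrd x

/-- `n ∈ ω`. -/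
def IsNat (n : M) : Prop := ∃ o : M, IsOmega o ∧ n ∈ o

/-- `n = 2 = {0, 1} = {∅, {∅}}`. -/
def IsTwo (n : M) : Prop :=
  ∃ z i : M, IsEmptySet z ∧ IsUPair z z i ∧ IsUPair z i n

/-- `|x| < n`, for `n ∈ ω`: the set `x` is equinumerous with some `m ∈ n`. -/
def CardLT (x n : M) : Prop := ∃ m : M, m ∈ n ∧ Equinum x m

/-- `x` is finite. -/
def IsFin (x : M) : Prop := ∃ n : M, IsNat n ∧ Equinum x n

/-- `|x| = ω`. -/
def IsCountablyInfinite (x : M) : Prop := ∃ o : M, IsOmega o ∧ Equinum x o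

/-- `w = ω₁`, the least ordinal that is neither finite nor of cardinality `ω`. -/
def IsOmega1 (w : M) : Prop :=
  IsOrd w ∧ ¬ (IsFin w ∨ IsCountablyInfinite w) ∧
  ∀ x : M, x ∈ w → IsFin x ∨ IsCountablyInfinite x

/-- `f` is a uniform denumeration on `w`: its domain is `w`, and `f(α)` is a function from `ω` onto
`α` whenever `1 ≤ α < w`. -/
def IsUniformDenumeration (f w : M) : Prop :=
  IsFunOn f w ∧ ∀ α : M, α ∈ w → ¬ IsEmptySet α →
    ∃ g o : M, App f α g ∧ IsOmega o ∧ IsOnto g o α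

/-- The family `F` is `n`-almost disjoint. -/
def AlmostDisjoint (n F : M) : Prop :=
  ∀ A B : M, A ∈ F → B ∈ F → A ≠ B → ∃ c : M, IsInter A B c ∧ CardLT c n

/-- The family `F` is essentially disjoint: there is a function `f` on `F` with `f(A) ∈ [A]^{<ω}`
such that the sets `A \ f(A)`, `A ∈ F`, are pairwise disjoint. -/
def EssentiallyDisjoint (F : M) : Prop :=
  ∃ f : M, IsFunOn f F ∧
    (∀ A s : M, App f A s → IsSubset s A ∧ IsFin s) ∧
    ∀ A B s t : M, A ≠ B → App f A s → App f B t →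
      ¬ ∃ x : M, (x ∈ A ∧ ¬ x ∈ s) ∧ (x ∈ B ∧ ¬ x ∈ t)

/-- `M(k, ω, n) → ED`: every `n`-almost disjoint family `F ⊆ [k]^ω` is essentially disjoint. -/
def MED (k n : M) : Prop :=
  ∀ F : M, (∀ A : M, A ∈ F → IsSubset A k ∧ IsCountablyInfinite A) →
    AlmostDisjoint n F → EssentiallyDisjoint F

/-- `f` is a function from `b` to `a` with cofinal range. -/
def IsCofinalMap (f b a : M) : Prop :=
  IsFun f b a ∧ ∀ x : M, x ∈ a → ∃ y z : M, App f y z ∧ (x ∈ z ∨ x = z)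

/-- `cf(a) = b`: `b` is the least ordinal that can be mapped cofinally into `a`. -/
def IsCf (a b : M) : Prop :=
  IsOrd b ∧ (∃ f : M, IsCofinalMap f b a) ∧
  ∀ c : M, c ∈ b → ¬ ∃ f : M, IsCofinalMap f c a

end Notions

/-- `UD(ω₁)` holds in `M`: there is a uniform denumeration on `ω₁`. -/
def UDOmega1 (M : Type u) [Membership M M] : Prop :=
  ∃ w : M, IsOmega1 w ∧ ∃ f : M, IsUniformDenumeration f w

/-- `M(ω₁, ω, n) → ED` holds in `M`. -/
def MEDOmega1 {M : Type u} [Membership M M] (n : M) : Prop :=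
  ∃ w : M, IsOmega1 w ∧ MED w n

/-- `cf(ω₁) = ω₁` holds in `M`. -/
def CfOmega1 (M : Type u) [Membership M M] : Prop :=
  ∃ w : M, IsOmega1 w ∧ IsCf w w

end ZFModel

/-! Without choice a countable union of countable sets may be uncountable, but a sequence of finite
sets of ordinals still has a finite or countable union: order points by the first index at which
they appear, then as ordinals (`fin_or_countablyInfinite_of_cover`). Hence no definable sequence of
finite sets covers `ω₁` (`IsOmega1.not_cover`). Both halves rest on this, and arbitrary choices are
replaced by least ordinals.

(1) Let `f` be a uniform denumeration. It bounds every definable `ω`-sequence in `ω₁`. By almost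
disjointness a member of the family is determined by any `n` of its points, so only finitely many
members meet a given finite set in `n` points. Closing off `ω` times gives arbitrarily large
ordinals `d < ω₁` that include every member they meet in `n` points. The level of `A` is the least
such `d` including `A`; its stage is the least `k` such that `A` has `n` points among the first `k`
values of `f(d)`. Compare members by level, then stage, and remove from `A` its points in other
members that are not higher. This removes finitely many points. Closed ordinals below the level of
`A` form a chain, each meeting `A` in fewer than `n` points; and only finitely many members have the
level of `A` and no larger stage, each meeting `A` in a finite set. Any two members are comparable,
so a common point is removed from at least one of them (`MED_of_isUniformDenumeration`).

(2) Suppose a smaller ordinal maps cofinally into `ω₁`. That ordinal is countable, so `ω₁` is an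
increasing union of bounded sets `G k`, `k ∈ ω`. Write each ordinal uniquely as `l + k` with `l` not
a successor and `k ∈ ω`. Rows fix `l`; the `k`-th column consists of the `l + k` with `l ∈ G k`.
Rows and columns form a 2-almost disjoint family. If finite sets could be removed to make it
disjoint, then for each `l` and all large `k` the point `l + k` would be removed from column `k`. So
finitely many points per column would capture every `l`, and adding natural numbers would cover `ω₁`
by a sequence of finite sets (`grid_not_essentiallyDisjoint`).

Separation and replacement apply only to definable classes, so the classes `Dfn`, `Tm`, `DPred`,
`DRel` and `DFun` let instance search build the required formulas. -/

namespace ZFModel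

universe u

variable {M : Type u} [Membership M M]

/-! ### Definability with parameters, by instance search. -/

section Definability

/-- A predicate of assignments of the variables `0, 1, 2, …` is definable with parameters. -/
class Dfn (P : (ℕ → M) → Prop) : Prop where
  out : ∃ φ : setLang.Formula (M ⊕ ℕ), ∀ g : ℕ → M, φ.Realize (Sum.elim id g) ↔ P g

/-- A term: a function of the assignment whose graph is definable. -/
class Tm (t : (ℕ → M) → M) : Prop where
  out : Dfn (fun g => g 0 = t (fun i => g (i + 1)))

/-- The predicate `P` is definable with parameters. -/
class DPred (P : M → Prop) : Prop where
  out : Dfn (fun g => P (g 0))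

/-- The binary relation `R` is definable with parameters. -/
class DRel (R : M → M → Prop) : Prop where
  out : Dfn (fun g => R (g 0) (g 1))

/-- The class function `F` is definable with parameters. -/
class DFun (F : M → M) : Prop where
  out : Dfn (fun g => g 0 = F (g 1))

theorem Dfn.congr {P Q : (ℕ → M) → Prop} (h : Dfn P) (hPQ : ∀ g, Q g ↔ P g) : Dfn Q := by
  obtain ⟨φ, hφ⟩ := h.out
  exact ⟨φ, fun g => (hφ g).trans (hPQ g).symm⟩

instance Dfn.not {P : (ℕ → M) → Prop} [h : Dfn P] : Dfn (fun g => ¬ P g) := by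
  obtain ⟨φ, hφ⟩ := h.out
  exact ⟨φ.not, fun g => by rw [FirstOrder.Language.Formula.realize_not, hφ]⟩

instance Dfn.imp {P Q : (ℕ → M) → Prop} [h : Dfn P] [h' : Dfn Q] : Dfn (fun g => P g → Q g) := by
  obtain ⟨φ, hφ⟩ := h.out
  obtain ⟨ψ, hψ⟩ := h'.out
  exact ⟨φ.imp ψ, fun g => by rw [FirstOrder.Language.Formula.realize_imp, hφ, hψ]⟩

instance Dfn.and {P Q : (ℕ → M) → Prop} [h : Dfn P] [h' : Dfn Q] : Dfn (fun g => P g ∧ Q g) := by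
  obtain ⟨φ, hφ⟩ := h.out
  obtain ⟨ψ, hψ⟩ := h'.out
  exact ⟨φ ⊓ ψ, fun g => by rw [FirstOrder.Language.Formula.realize_inf, hφ, hψ]⟩

instance Dfn.or {P Q : (ℕ → M) → Prop} [Dfn P] [Dfn Q] : Dfn (fun g => P g ∨ Q g) :=
  Dfn.congr (P := fun g => ¬ P g → Q g) inferInstance fun _ => or_iff_not_imp_left

instance Dfn.iff {P Q : (ℕ → M) → Prop} [Dfn P] [Dfn Q] : Dfn (fun g => P g ↔ Q g) :=
  Dfn.congr (P := fun g => (P g → Q g) ∧ (Q g → P g)) inferInstance fun _ => iff_iff_implies_and_implies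

/-- De Bruijn convention: the bound variable is number `0` and the outer variables move up by one.
-/
instance Dfn.ex {P : (ℕ → M) → M → Prop} [h : Dfn (fun g => P (fun i => g (i + 1)) (g 0))] :
    Dfn (fun g => ∃ y, P g y) := by
  obtain ⟨φ, hφ⟩ := h.out
  refine ⟨(φ.relabel (Sum.elim (fun m => Sum.inl (Sum.inl m))
    (fun i => Nat.casesOn i (Sum.inr ()) (fun j => Sum.inl (Sum.inr j)))) :
      setLang.Formula ((M ⊕ ℕ) ⊕ Unit)).iExs Unit, fun g => ?_⟩
  rw [FirstOrder.Language.Formula.realize_iExs]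
  have key : ∀ y : M, (fun i => Nat.casesOn i y g : ℕ → M) 0 = y := fun _ => rfl
  constructor
  · rintro ⟨i, hi⟩
    refine ⟨i (), ?_⟩
    rw [FirstOrder.Language.Formula.realize_relabel] at hi
    have := (hφ (fun n => Nat.casesOn n (i ()) g)).1 ?_
    · exact this
    · convert hi using 1
      funext x
      rcases x with m | (_ | n) <;> rfl
  · rintro ⟨y, hy⟩
    refine ⟨fun _ => y, ?_⟩
    rw [FirstOrder.Language.Formula.realize_relabel]
    have := (hφ (fun n => Nat.casesOn n y g)).2 hy
    convert this using 1
    funext x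
    rcases x with m | (_ | n) <;> rfl

instance Dfn.all {P : (ℕ → M) → M → Prop} [Dfn (fun g => P (fun i => g (i + 1)) (g 0))] :
    Dfn (fun g => ∀ y, P g y) :=
  Dfn.congr (P := fun g => ¬ ∃ y, ¬ P g y) inferInstance fun _ => by push Not; rfl

theorem Dfn.var_eq (n m : ℕ) : Dfn (fun g : ℕ → M => g n = g m) :=
  ⟨(FirstOrder.Language.Term.var (Sum.inr n)).equal (FirstOrder.Language.Term.var (Sum.inr m)),
    fun g => by rw [FirstOrder.Language.Formula.realize_equal]; rfl⟩

theorem Dfn.var_eq_const (n : ℕ) (c : M) : Dfn (fun g : ℕ → M => g n = c) :=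
  ⟨(FirstOrder.Language.Term.var (Sum.inr n)).equal (FirstOrder.Language.Term.var (Sum.inl c)),
    fun g => by rw [FirstOrder.Language.Formula.realize_equal]; rfl⟩

theorem Dfn.var_mem (n m : ℕ) : Dfn (fun g : ℕ → M => g n ∈ g m) :=
  ⟨memSymb.formula₂ (FirstOrder.Language.Term.var (Sum.inr n))
    (FirstOrder.Language.Term.var (Sum.inr m)),
    fun g => by rw [FirstOrder.Language.Formula.realize_rel₂]; exact relMap_memSymb _⟩

/-- Definable predicates are closed under changing the names of the variables. -/
theorem Dfn.rename {P : (ℕ → M) → Prop} (h : Dfn P) (r : ℕ → ℕ) :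
    Dfn (fun g => P (fun i => g (r i))) := by
  obtain ⟨φ, hφ⟩ := h.out
  refine ⟨φ.relabel (Sum.map id r), fun g => ?_⟩
  rw [FirstOrder.Language.Formula.realize_relabel, ← hφ]
  have : (Sum.elim id g ∘ Sum.map id r : M ⊕ ℕ → M) = Sum.elim id fun i => g (r i) := by
    funext x
    rcases x with m | n <;> rfl
  rw [this]

instance Tm.var (n : ℕ) : Tm (fun g : ℕ → M => g n) := ⟨Dfn.var_eq 0 (n + 1)⟩

instance Tm.const (c : M) : Tm (fun _ : ℕ → M => c) := ⟨Dfn.var_eq_const 0 c⟩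

instance Tm.rename {t : (ℕ → M) → M} [h : Tm t] (r : ℕ → ℕ) : Tm (fun g => t (fun i => g (r i))) :=
  ⟨(h.out.rename (fun i => Nat.casesOn i 0 (fun j => r j + 1))).congr fun _ => Iff.rfl⟩

/-- Substitution of a term for the variable `0`. -/
theorem Dfn.subst {P : (ℕ → M) → M → Prop} (h : Dfn (fun g => P (fun i => g (i + 1)) (g 0)))
    (t : (ℕ → M) → M) [ht : Tm t] : Dfn (fun g => P g (t g)) := by
  -- The language has no function symbols, so `P (t)` is expressed as `∃ y, y = t ∧ P y`.
  have h1 : Dfn (fun g => (fun (g : ℕ → M) (y : M) => y = t g ∧ P g y)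
      (fun i => g (i + 1)) (g 0)) :=
    have := ht.out
    Dfn.and (P := fun g => g 0 = t fun i => g (i + 1)) (Q := fun g => P (fun i => g (i + 1)) (g 0))
  exact (Dfn.ex (P := fun (g : ℕ → M) (y : M) => y = t g ∧ P g y)).congr fun g => by simp

instance Dfn.of_dPred {P : M → Prop} {a : (ℕ → M) → M} [h : DPred P] [Tm a] :
    Dfn (fun g => P (a g)) := Dfn.subst (P := fun _ y => P y) h.out a

instance Dfn.of_dRel {R : M → M → Prop} {a b : (ℕ → M) → M} [h : DRel R] [Tm a] [Tm b] :
    Dfn (fun g => R (a g) (b g)) := by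
  have h1 : Dfn (fun g : ℕ → M => R (g 0) (b fun i => g (i + 1))) :=
    Dfn.subst (P := fun g y => R (g 0) y) (h.out.rename fun i => Nat.casesOn i 1 fun _ => 0)
      (fun g => b fun i => g (i + 1))
  exact Dfn.subst (P := fun g y => R y (b g)) h1 a

instance Tm.of_dFun {F : M → M} {a : (ℕ → M) → M} [h : DFun F] [Tm a] : Tm (fun g => F (a g)) := by
  refine ⟨?_⟩
  exact Dfn.subst (P := fun g y => g 0 = F y) (h.out.rename fun i => Nat.casesOn i 1 fun _ => 0)
    (fun g => a fun i => g (i + 1))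

instance {P : M → Prop} [h : Dfn (fun g => P (g 0))] : DPred P := ⟨h⟩

instance {R : M → M → Prop} [h : Dfn (fun g => R (g 0) (g 1))] : DRel R := ⟨h⟩

instance {F : M → M} [h : Tm (fun g => F (g 0))] : DFun F := ⟨h.out⟩

instance Dfn.eq {s t : (ℕ → M) → M} [Tm s] [ht : Tm t] : Dfn (fun g => s g = t g) :=
  Dfn.subst (P := fun g y => y = t g) ht.out s

instance Dfn.ne {s t : (ℕ → M) → M} [Tm s] [Tm t] : Dfn (fun g => s g ≠ t g) :=
  Dfn.not (P := fun g => s g = t g)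

instance Dfn.mem {s t : (ℕ → M) → M} [Tm s] [Tm t] : Dfn (fun g => s g ∈ t g) := by
  have h : ∀ n, Dfn (fun g : ℕ → M => g n ∈ t g) := fun n =>
    Dfn.subst (P := fun g y => g n ∈ y) (Dfn.var_mem (n + 1) 0) t
  have h1 : Dfn (fun g : ℕ → M => g 0 ∈ t (fun i => g (i + 1))) :=
    Dfn.subst (P := fun g y => g 0 ∈ y) (Dfn.var_mem 1 0) (fun g => t (fun i => g (i + 1)))
  exact Dfn.subst (P := fun g y => y ∈ t g) h1 s

instance Dfn.true : Dfn (fun _ : ℕ → M => True) :=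
  (Dfn.var_eq 0 0).congr fun _ => by simp

instance Dfn.false : Dfn (fun _ : ℕ → M => False) :=
  Dfn.congr (P := fun _ => ¬ True) inferInstance fun _ => by simp

instance Dfn.existsUnique {P : (ℕ → M) → M → Prop}
    [h : Dfn (fun g => P (fun i => g (i + 1)) (g 0))] : Dfn (fun g => ∃! y, P g y) := by
  -- Under the inner quantifier over `z` the parameters are shifted twice; instance search needs
  -- this form as a hypothesis.
  have h2 : Dfn (fun g => P (fun i => g (i + 2)) (g 0)) :=
    h.rename (fun i => Nat.casesOn i 0 (fun j => j + 2))
  exact Dfn.congr (P := fun g => ∃ y, P g y ∧ ∀ z, P g z → z = y) inferInstance fun _ => Iff.rfl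

open Classical in
/-- Definite description: the unique `y` with `P y`. -/
noncomputable def the {M : Type u} [Nonempty M] (P : M → Prop) : M :=
  if h : ∃! y, P y then h.choose else Classical.arbitrary M

theorem the_spec {M : Type u} [Nonempty M] {P : M → Prop} (h : ∃! y, P y) : P (the P) := by
  rw [the, dif_pos h]
  exact h.choose_spec.1

theorem the_eq {M : Type u} [Nonempty M] {P : M → Prop} {y : M} (hy : P y) (h : ∀ z, P z → z = y) :
    the P = y := h _ (the_spec ⟨y, hy, h⟩)

instance Tm.the [Nonempty M] {P : (ℕ → M) → M → Prop}
    [h : Dfn (fun g => P (fun i => g (i + 1)) (g 0))] : Tm (fun g => the (fun y => P g y)) := by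
  have h1 : Dfn (fun g => P (fun i => g (i + 2)) (g 0)) :=
    h.rename (fun i => Nat.casesOn i 0 (fun j => j + 2))
  have h2 : Dfn (fun g => P (fun i => g (i + 1)) (g 0)) := h
  -- The default value of `the` is a fixed element of `M`, hence usable as a parameter.
  refine ⟨Dfn.congr (P := fun g => (P (fun i => g (i + 1)) (g 0) ∧ ∃! y, P (fun i => g (i + 1)) y) ∨
    ((¬ ∃! y, P (fun i => g (i + 1)) y) ∧ g 0 = Classical.arbitrary M)) inferInstance fun g => ?_⟩
  by_cases H : ∃! y, P (fun i => g (i + 1)) y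
  · constructor
    · intro h3
      rw [h3]
      exact Or.inl ⟨the_spec H, H⟩
    · rintro (⟨h3, h4⟩ | ⟨h3, -⟩)
      · exact h4.unique h3 (the_spec H)
      · exact absurd H h3
  · simp [ZFModel.the, H]

end Definability

/-! ### Definability of the set-theoretic notions. -/

section Instances

instance {a b : (ℕ → M) → M} [Tm a] [Tm b] : Dfn (fun g => IsSubset (a g) (b g)) := by
  unfold IsSubset; infer_instance
instance {a b c : (ℕ → M) → M} [Tm a] [Tm b] [Tm c] :
    Dfn (fun g => IsUPair (a g) (b g) (c g)) := by
  unfold IsUPair; infer_instance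
instance {a b c : (ℕ → M) → M} [Tm a] [Tm b] [Tm c] :
    Dfn (fun g => IsOPair (a g) (b g) (c g)) := by
  unfold IsOPair; infer_instance
instance {a b c : (ℕ → M) → M} [Tm a] [Tm b] [Tm c] :
    Dfn (fun g => App (a g) (b g) (c g)) := by
  unfold App; infer_instance
instance {a b : (ℕ → M) → M} [Tm a] [Tm b] : Dfn (fun g => IsFunOn (a g) (b g)) := by
  unfold IsFunOn; infer_instance
instance {a b c : (ℕ → M) → M} [Tm a] [Tm b] [Tm c] :
    Dfn (fun g => IsFun (a g) (b g) (c g)) := by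
  unfold IsFun; infer_instance
instance {a b c : (ℕ → M) → M} [Tm a] [Tm b] [Tm c] :
    Dfn (fun g => IsOnto (a g) (b g) (c g)) := by
  unfold IsOnto; infer_instance
instance {a b c : (ℕ → M) → M} [Tm a] [Tm b] [Tm c] :
    Dfn (fun g => IsBij (a g) (b g) (c g)) := by
  unfold IsBij; infer_instance
instance {a b : (ℕ → M) → M} [Tm a] [Tm b] : Dfn (fun g => Equinum (a g) (b g)) := by
  unfold Equinum; infer_instance
instance {a : (ℕ → M) → M} [Tm a] : Dfn (fun g => IsOrd (a g)) := by
  unfold IsOrd; infer_instance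
instance {a : (ℕ → M) → M} [Tm a] : Dfn (fun g => IsLimitOrd (a g)) := by
  unfold IsLimitOrd; infer_instance
instance {a : (ℕ → M) → M} [Tm a] : Dfn (fun g => IsOmega (a g)) := by
  unfold IsOmega; infer_instance
instance {a : (ℕ → M) → M} [Tm a] : Dfn (fun g => IsNat (a g)) := by
  unfold IsNat; infer_instance
instance {a : (ℕ → M) → M} [Tm a] : Dfn (fun g => IsFin (a g)) := by
  unfold IsFin; infer_instance
instance {a : (ℕ → M) → M} [Tm a] : Dfn (fun g => IsCountablyInfinite (a g)) := by
  unfold IsCountablyInfinite; infer_instance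

end Instances

/-! ### Elementary set operations, functions and equinumerosity. -/

section SetOperations

variable [hM : Fact (ModelsZF M)]

instance nonempty_model : Nonempty M := hM.out.infinity.nonempty

theorem set_ext {x y : M} (h : ∀ z, z ∈ x ↔ z ∈ y) : x = y := hM.out.extensionality x y h

/-- The elements of a set given by definite description of its elements. -/
theorem mem_the {P : M → Prop} (h : ∃ y : M, ∀ z, z ∈ y ↔ P z) (z : M) :
    z ∈ the (fun y : M => ∀ z, z ∈ y ↔ P z) ↔ P z := by
  obtain ⟨y, hy⟩ := h
  exact the_spec (P := fun y : M => ∀ z, z ∈ y ↔ P z)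
    ⟨y, hy, fun y' hy' => set_ext fun z => (hy' z).trans (hy z).symm⟩ z

theorem exists_sep (P : M → Prop) [h : DPred P] (a : M) : ∃ b : M, ∀ x, x ∈ b ↔ x ∈ a ∧ P x := by
  obtain ⟨φ, hφ⟩ := h.out.out
  have c := Classical.arbitrary M
  -- Only variable `0` matters; all the others are replaced by an arbitrary parameter `c`.
  obtain ⟨b, hb⟩ := hM.out.separation (φ.relabel (Sum.elim Sum.inl
    (fun i => Nat.casesOn i (Sum.inr 0) (fun _ => Sum.inl c)))) a
  refine ⟨b, fun x => (hb x).trans (and_congr_right fun _ => ?_)⟩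
  rw [FirstOrder.Language.Formula.realize_relabel]
  refine Iff.trans (iff_of_eq ?_) (hφ (fun i => Nat.casesOn i x (fun _ => c)))
  congr 1
  funext i
  rcases i with m | (_ | n) <;> rfl

theorem exists_repl (F : M → M) [h : DFun F] (a : M) :
    ∃ b : M, ∀ y, y ∈ b ↔ ∃ x, x ∈ a ∧ y = F x := by
  have hd : Dfn (fun g : ℕ → M => g 1 = F (g 0)) := inferInstance
  obtain ⟨φ, hφ⟩ := hd.out
  have c := Classical.arbitrary M
  have key : ∀ x y : M, (φ.relabel (Sum.elim Sum.inl
      (fun i => Nat.casesOn i (Sum.inr 0) (fun j => Nat.casesOn j (Sum.inr 1)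
      (fun _ => Sum.inl c)))) : setLang.Formula (M ⊕ Fin 2)).Realize (Sum.elim id ![x, y]) ↔
      y = F x := by
    intro x y
    rw [FirstOrder.Language.Formula.realize_relabel]
    refine Iff.trans (iff_of_eq ?_)
      (hφ (fun i => Nat.casesOn i x (fun j => Nat.casesOn j y (fun _ => c))))
    congr 1
    funext i
    rcases i with m | (_ | (_ | n)) <;> rfl
  obtain ⟨b, hb⟩ := hM.out.replacement _ a fun x _ y z hy hz =>
    ((key x y).1 hy).trans ((key x z).1 hz).symm
  exact ⟨b, fun y => (hb y).trans (exists_congr fun x => and_congr_right fun _ => key x y)⟩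

/-- `{x ∈ a | P x}` -/
noncomputable def sep (a : M) (P : M → Prop) : M := the fun b => ∀ x, x ∈ b ↔ x ∈ a ∧ P x

@[simp] theorem mem_sep {P : M → Prop} [DPred P] {a x : M} : x ∈ sep a P ↔ x ∈ a ∧ P x :=
  mem_the (exists_sep P a) x

instance {a : (ℕ → M) → M} {P : (ℕ → M) → M → Prop} [Tm a]
    [h : Dfn (fun g => P (fun i => g (i + 1)) (g 0))] : Tm (fun g => sep (a g) (fun x => P g x)) := by
  have h2 : Dfn (fun g => P (fun i => g (i + 2)) (g 0)) :=
    h.rename (fun i => Nat.casesOn i 0 (fun j => j + 2))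
  unfold sep
  exact Tm.the (P := fun g b => ∀ x, x ∈ b ↔ x ∈ a g ∧ P g x)

/-- `{F x | x ∈ a}` -/
noncomputable def repl (a : M) (F : M → M) : M := the fun b => ∀ y, y ∈ b ↔ ∃ x, x ∈ a ∧ y = F x

@[simp] theorem mem_repl {F : M → M} [DFun F] {a y : M} : y ∈ repl a F ↔ ∃ x, x ∈ a ∧ y = F x :=
  mem_the (exists_repl F a) y

instance {a : (ℕ → M) → M} {F : (ℕ → M) → M → M} [Tm a]
    [h : Tm (fun g => F (fun i => g (i + 1)) (g 0))] : Tm (fun g => repl (a g) (fun x => F g x)) := by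
  have h2 : Tm (fun g => F (fun i => g (i + 3)) (g 0)) :=
    Tm.rename (t := fun g => F (fun i => g (i + 1)) (g 0))
      (fun i => Nat.casesOn i 0 (fun j => j + 3))
  unfold repl
  exact Tm.the (P := fun g b => ∀ y, y ∈ b ↔ ∃ x, x ∈ a g ∧ y = F g x)

/-- The empty set. -/
noncomputable def emp : M := the fun y => ∀ z : M, z ∈ y ↔ False

omit hM in
theorem isEmptySet_iff {x : M} : IsEmptySet x ↔ ∀ z : M, z ∈ x ↔ False := by
  simp [IsEmptySet]

@[simp] theorem not_mem_emp (z : M) : ¬ z ∈ (emp : M) := by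
  obtain ⟨-, ⟨y, hy, -⟩, -⟩ := hM.out.infinity
  exact (mem_the ⟨y, isEmptySet_iff.1 hy⟩ z).1

theorem eq_emp {x : M} (h : ∀ z, ¬ z ∈ x) : x = emp := set_ext fun z => by simp [h z]

theorem exists_mem_of_ne {x : M} (h : x ≠ emp) : ∃ z, z ∈ x := by
  by_contra! h'
  exact h (eq_emp h')

theorem isEmptySet_eq {x : M} : IsEmptySet x ↔ x = emp :=
  ⟨fun h => eq_emp h, fun h => h ▸ not_mem_emp⟩

/-- `{a, b}` -/
noncomputable def upair (a b : M) : M := the fun p => ∀ z : M, z ∈ p ↔ z = a ∨ z = b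

@[simp] theorem mem_upair {a b z : M} : z ∈ upair a b ↔ z = a ∨ z = b :=
  mem_the (hM.out.pairing a b) z

instance {a b : (ℕ → M) → M} [Tm a] [Tm b] : Tm (fun g => upair (a g) (b g)) := by
  unfold upair; infer_instance

/-- `⋃ x` -/
noncomputable def sUn (x : M) : M := the fun y => ∀ z : M, z ∈ y ↔ ∃ w, w ∈ x ∧ z ∈ w

@[simp] theorem mem_sUn {x z : M} : z ∈ sUn x ↔ ∃ w, w ∈ x ∧ z ∈ w :=
  mem_the (hM.out.union x) z

instance {a : (ℕ → M) → M} [Tm a] : Tm (fun g => sUn (a g)) := by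
  unfold sUn; infer_instance

/-- The power set. -/
noncomputable def pow (x : M) : M := the fun y => ∀ z : M, z ∈ y ↔ IsSubset z x

@[simp] theorem mem_pow {x z : M} : z ∈ pow x ↔ IsSubset z x :=
  mem_the (hM.out.powerset x) z

instance {a : (ℕ → M) → M} [Tm a] : Tm (fun g => pow (a g)) := by
  unfold pow; infer_instance

/-- `a ∪ b` -/
noncomputable def un (a b : M) : M := sUn (upair a b)

@[simp] theorem mem_un {a b z : M} : z ∈ un a b ↔ z ∈ a ∨ z ∈ b := by simp [un]

instance {a b : (ℕ → M) → M} [Tm a] [Tm b] : Tm (fun g => un (a g) (b g)) := by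
  unfold un; infer_instance

/-- `{x} ∪ s` -/
noncomputable def ins (x s : M) : M := un (upair x x) s

@[simp] theorem mem_ins {x s z : M} : z ∈ ins x s ↔ z = x ∨ z ∈ s := by simp [ins]

instance {a b : (ℕ → M) → M} [Tm a] [Tm b] : Tm (fun g => ins (a g) (b g)) := by
  unfold ins; infer_instance

/-- `x ∪ {x}` -/
noncomputable def suc (x : M) : M := ins x x

@[simp] theorem mem_suc {x z : M} : z ∈ suc x ↔ z = x ∨ z ∈ x := by simp [suc]

instance {a : (ℕ → M) → M} [Tm a] : Tm (fun g => suc (a g)) := by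
  unfold suc; infer_instance

theorem isSucc_eq {x s : M} : IsSucc x s ↔ s = suc x :=
  ⟨fun h => set_ext fun z => by rw [h z, mem_suc, or_comm], fun h z => by rw [h, mem_suc, or_comm]⟩

/-- `⋃ {F x | x ∈ a}` -/
noncomputable def bUn (a : M) (F : M → M) : M := sUn (repl a F)

@[simp] theorem mem_bUn {F : M → M} [DFun F] {a z : M} : z ∈ bUn a F ↔ ∃ x, x ∈ a ∧ z ∈ F x := by
  simp only [bUn, mem_sUn, mem_repl]
  exact ⟨fun ⟨w, ⟨x, hx, hw⟩, hz⟩ => ⟨x, hx, hw ▸ hz⟩, fun ⟨x, hx, hz⟩ => ⟨_, ⟨x, hx, rfl⟩, hz⟩⟩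

instance {a : (ℕ → M) → M} {F : (ℕ → M) → M → M} [Tm a]
    [h : Tm (fun g => F (fun i => g (i + 1)) (g 0))] : Tm (fun g => bUn (a g) (fun x => F g x)) := by
  unfold bUn; infer_instance

/-- `a ∩ b` -/
noncomputable def int (a b : M) : M := sep a fun x => x ∈ b

@[simp] theorem mem_int {a b z : M} : z ∈ int a b ↔ z ∈ a ∧ z ∈ b := by simp [int]

instance {a b : (ℕ → M) → M} [Tm a] [Tm b] : Tm (fun g => int (a g) (b g)) := by
  unfold int; infer_instance

theorem isInter_eq {a b c : M} : IsInter a b c ↔ c = int a b :=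
  ⟨fun h => set_ext fun z => by rw [h z, mem_int], fun h z => by rw [h, mem_int]⟩

/-- `(a, b)` -/
noncomputable def opair (a b : M) : M := upair (upair a a) (upair a b)

instance {a b : (ℕ → M) → M} [Tm a] [Tm b] : Tm (fun g => opair (a g) (b g)) := by
  unfold opair; infer_instance

theorem isUPair_eq {a b p : M} : IsUPair a b p ↔ p = upair a b :=
  ⟨fun h => set_ext fun z => by rw [h z, mem_upair], fun h z => by rw [h, mem_upair]⟩

theorem isOPair_eq {a b p : M} : IsOPair a b p ↔ p = opair a b := by
  simp [IsOPair, isUPair_eq, opair]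

theorem upair_inj {a b c d : M} (h : upair a b = upair c d) : (a = c ∧ b = d) ∨ (a = d ∧ b = c) := by
  have h1 : ∀ z, (z = a ∨ z = b) ↔ (z = c ∨ z = d) := fun z => by
    rw [← mem_upair, h, mem_upair]
  have ha := (h1 a).1 (Or.inl rfl)
  have hb := (h1 b).1 (Or.inr rfl)
  have hc := (h1 c).2 (Or.inl rfl)
  have hd := (h1 d).2 (Or.inr rfl)
  grind

theorem opair_inj {a b c d : M} : opair a b = opair c d ↔ a = c ∧ b = d := by
  refine ⟨fun h => ?_, fun ⟨h1, h2⟩ => by rw [h1, h2]⟩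
  rcases upair_inj h with ⟨h1, h2⟩ | ⟨h1, h2⟩
  · rcases upair_inj h1 with ⟨h3, -⟩ | ⟨h3, -⟩ <;> rcases upair_inj h2 with ⟨h5, h6⟩ | ⟨h5, h6⟩ <;>
      grind
  · rcases upair_inj h1 with ⟨h3, h4⟩ | ⟨h3, h4⟩ <;> rcases upair_inj h2 with ⟨h5, h6⟩ | ⟨h5, h6⟩ <;>
      grind

theorem app_iff {f x y : M} : App f x y ↔ opair x y ∈ f := by
  simp [App, isOPair_eq]

theorem app_ins {f x y a b : M} : App (ins (opair a b) f) x y ↔ (x = a ∧ y = b) ∨ App f x y := by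
  rw [app_iff, mem_ins, opair_inj, app_iff]

/-- The value `f(x)`. -/
noncomputable def ap (f x : M) : M := the fun y => App f x y

instance {a b : (ℕ → M) → M} [Tm a] [Tm b] : Tm (fun g => ap (a g) (b g)) := by
  unfold ap; infer_instance

theorem IsFunOn.app_ap {f X x : M} (h : IsFunOn f X) (hx : x ∈ X) : App f x (ap f x) :=
  the_spec (h.2 x hx)

theorem IsFunOn.mem_dom {f X x y : M} (h : IsFunOn f X) (hxy : App f x y) : x ∈ X := by
  rw [app_iff] at hxy
  obtain ⟨x', y', hx', hp⟩ := h.1 _ hxy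
  rw [isOPair_eq, opair_inj] at hp
  exact hp.1 ▸ hx'

theorem IsFunOn.ap_eq {f X x y : M} (h : IsFunOn f X) (hxy : App f x y) : ap f x = y :=
  (h.2 x (h.mem_dom hxy)).unique (h.app_ap (h.mem_dom hxy)) hxy

/-- A definable class function restricts to a function on each set. -/
theorem exists_fun (F : M → M) [DFun F] (X : M) :
    ∃ f : M, IsFunOn f X ∧ ∀ x y, App f x y ↔ x ∈ X ∧ y = F x := by
  have key : ∀ x y, App (repl X fun x => opair x (F x)) x y ↔ x ∈ X ∧ y = F x := by
    intro x y
    rw [app_iff, mem_repl]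
    constructor
    · rintro ⟨x', hx', h⟩
      rw [opair_inj] at h
      rw [h.1, h.2]
      exact ⟨hx', rfl⟩
    · rintro ⟨hx, rfl⟩
      exact ⟨x, hx, rfl⟩
  refine ⟨repl X fun x => opair x (F x), ⟨fun p hp => ?_, fun x hx => ?_⟩, key⟩
  · rw [mem_repl] at hp
    obtain ⟨x, hx, rfl⟩ := hp
    exact ⟨x, F x, hx, isOPair_eq.2 rfl⟩
  · exact ⟨F x, (key _ _).2 ⟨hx, rfl⟩, fun y hy => ((key _ _).1 hy).2⟩

theorem equinum_of_fun (F : M → M) [DFun F] {X Y : M} (h1 : ∀ x, x ∈ X → F x ∈ Y)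
    (h2 : ∀ x x', x ∈ X → x' ∈ X → F x = F x' → x = x')
    (h3 : ∀ y, y ∈ Y → ∃ x, x ∈ X ∧ y = F x) : Equinum X Y := by
  obtain ⟨f, hf, hF⟩ := exists_fun F X
  refine ⟨f, ⟨⟨hf, fun x y hxy => ?_⟩, fun y hy => ?_⟩, fun x x' y hx hx' => ?_⟩
  · rw [hF] at hxy
    exact hxy.2 ▸ h1 x hxy.1
  · obtain ⟨x, hx, hy⟩ := h3 y hy
    exact ⟨x, (hF _ _).2 ⟨hx, hy⟩⟩
  · rw [hF] at hx hx'
    exact h2 x x' hx.1 hx'.1 (hx.2.symm.trans hx'.2)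

/-- Evaluation of a bijection that is an element of `M` is definable with that element as parameter.
-/
theorem Equinum.exists_fun {X Y : M} (h : Equinum X Y) : ∃ F : M → M, DFun F ∧
    (∀ x, x ∈ X → F x ∈ Y) ∧ (∀ x x', x ∈ X → x' ∈ X → F x = F x' → x = x') ∧
    ∀ y, y ∈ Y → ∃ x, x ∈ X ∧ y = F x := by
  obtain ⟨f, ⟨⟨hf, h1⟩, h2⟩, h3⟩ := h
  refine ⟨fun x => ap f x, inferInstance, fun x hx => h1 _ _ (hf.app_ap hx), fun x x' hx hx' he => ?_,
    fun y hy => ?_⟩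
  · have he : ap f x = ap f x' := he
    exact h3 _ _ _ (hf.app_ap hx) (by rw [he]; exact hf.app_ap hx')
  · obtain ⟨x, hx⟩ := h2 y hy
    exact ⟨x, hf.mem_dom hx, (hf.ap_eq hx).symm⟩

/-- A set is equinumerous with its image under an injective class function. -/
theorem equinum_repl (F : M → M) [DFun F] {X : M}
    (h2 : ∀ x x', x ∈ X → x' ∈ X → F x = F x' → x = x') : Equinum X (repl X F) :=
  equinum_of_fun F (fun x hx => mem_repl.2 ⟨x, hx, rfl⟩) h2 fun _ hy => mem_repl.1 hy

theorem Equinum.refl (X : M) : Equinum X X :=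
  equinum_of_fun (fun x => x) (fun _ h => h) (fun _ _ _ _ h => h) fun y hy => ⟨y, hy, rfl⟩

theorem Equinum.trans {X Y Z : M} (h : Equinum X Y) (h' : Equinum Y Z) : Equinum X Z := by
  obtain ⟨F, _, h1, h2, h3⟩ := h.exists_fun
  obtain ⟨G, _, h1', h2', h3'⟩ := h'.exists_fun
  refine equinum_of_fun (fun x => G (F x)) (fun x hx => h1' _ (h1 _ hx)) (fun x x' hx hx' he =>
    h2 _ _ hx hx' (h2' _ _ (h1 _ hx) (h1 _ hx') he)) fun z hz => ?_
  obtain ⟨y, hy, rfl⟩ := h3' z hz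
  obtain ⟨x, hx, rfl⟩ := h3 y hy
  exact ⟨x, hx, rfl⟩

theorem Equinum.symm {X Y : M} (h : Equinum X Y) : Equinum Y X := by
  obtain ⟨F, _, h1, h2, h3⟩ := h.exists_fun
  have key : ∀ x, x ∈ X → the (fun z => z ∈ X ∧ F x = F z) = x := fun x hx =>
    the_eq ⟨hx, rfl⟩ fun z hz => (h2 _ _ hx hz.1 hz.2).symm
  refine equinum_of_fun (fun y => the fun x => x ∈ X ∧ y = F x) ?_ ?_ ?_
  · intro y hy
    obtain ⟨x, hx, rfl⟩ := h3 y hy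
    rwa [key x hx]
  · intro y y' hy hy' he
    obtain ⟨x, hx, rfl⟩ := h3 y hy
    obtain ⟨x', hx', rfl⟩ := h3 y' hy'
    rw [key x hx, key x' hx'] at he
    rw [he]
  · exact fun x hx => ⟨F x, h1 x hx, (key x hx).symm⟩

end SetOperations

/-! ### Ordinals from foundation. -/

section Ordinals

variable [hM : Fact (ModelsZF M)]

theorem exists_min_of_mem (P : M → Prop) [DPred P] (a : M) (h : ∃ x, x ∈ a ∧ P x) :
    ∃ x, x ∈ a ∧ P x ∧ ∀ y, y ∈ a → P y → ¬ y ∈ x := by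
  obtain ⟨x, hx, hP⟩ := h
  obtain ⟨y, hy, hmin⟩ := hM.out.foundation (sep a P) ⟨x, mem_sep.2 ⟨hx, hP⟩⟩
  exact ⟨y, (mem_sep.1 hy).1, (mem_sep.1 hy).2, fun z hz hPz => hmin z (mem_sep.2 ⟨hz, hPz⟩)⟩

theorem not_mem_self (x : M) : ¬ x ∈ x := by
  intro h
  obtain ⟨y, hy, hmin⟩ := hM.out.foundation (upair x x) ⟨x, by simp⟩
  rw [mem_upair, or_self] at hy
  exact hmin x (by simp) (hy.symm ▸ h)

theorem not_mem_of_mem {x y : M} (h : x ∈ y) : ¬ y ∈ x := by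
  intro h'
  obtain ⟨z, hz, hmin⟩ := hM.out.foundation (upair x y) ⟨x, by simp⟩
  rcases mem_upair.1 hz with rfl | rfl
  · exact hmin y (by simp) h'
  · exact hmin x (by simp) h

theorem not_mem_cycle {x y z : M} (h : x ∈ y) (h' : y ∈ z) : ¬ z ∈ x := by
  intro h''
  obtain ⟨w, hw, hmin⟩ := hM.out.foundation (ins z (upair x y)) ⟨x, by simp⟩
  rcases mem_ins.1 hw with rfl | hw
  · exact hmin y (by simp) h'
  · rcases mem_upair.1 hw with rfl | rfl
    · exact hmin z (by simp) h''
    · exact hmin x (by simp) h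

omit hM in
theorem IsOrd.trans {x y z : M} (h : IsOrd x) (hy : y ∈ x) (hz : z ∈ y) : z ∈ x := h.1 y hy z hz

theorem IsOrd.of_mem {x y : M} (h : IsOrd x) (hy : y ∈ x) : IsOrd y := by
  refine ⟨fun z hz w hw => ?_, fun z w hz hw => h.2 z w (h.trans hy hz) (h.trans hy hw)⟩
  rcases h.2 w y (h.trans (h.trans hy hz) hw) hy with h1 | h1 | h1
  · exact h1
  · exact absurd hz (h1 ▸ not_mem_of_mem hw)
  · exact absurd h1 (not_mem_cycle hw hz)

/-- A transitive proper subset of an ordinal is an element. -/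
theorem IsOrd.mem_of_subset {x y : M} (h : IsOrd x) (hy : IsSubset y x)
    (ht : ∀ z, z ∈ y → IsSubset z y) (hne : y ≠ x) : y ∈ x := by
  have h1 : ∃ z, z ∈ x ∧ ¬ z ∈ y := by
    by_contra! h1
    exact hne (set_ext fun z => ⟨hy z, h1 z⟩)
  obtain ⟨z, hz, hzy, hmin⟩ := exists_min_of_mem (fun z => ¬ z ∈ y) x h1
  have : y = z := by
    refine set_ext fun w => ⟨fun hw => ?_, fun hw => ?_⟩
    · rcases h.2 w z (hy w hw) hz with h2 | h2 | h2
      · exact h2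
      · exact absurd (h2 ▸ hw) hzy
      · exact absurd (ht w hw z h2) hzy
    · by_contra h2
      exact hmin w (h.trans hz hw) h2 hw
  exact this ▸ hz

/-- The intersection is transitive; if it were proper in both ordinals it would belong to both,
hence to itself. -/
theorem IsOrd.trichotomy {x y : M} (hx : IsOrd x) (hy : IsOrd y) : x ∈ y ∨ x = y ∨ y ∈ x := by
  have ht : ∀ z, z ∈ int x y → IsSubset z (int x y) := by
    intro z hz w hw
    rw [mem_int] at hz ⊢
    exact ⟨hx.trans hz.1 hw, hy.trans hz.2 hw⟩
  by_cases h1 : int x y = x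
  · by_cases h2 : int x y = y
    · exact Or.inr (Or.inl (h1.symm.trans h2))
    · exact Or.inl (h1 ▸ hy.mem_of_subset (fun z hz => (mem_int.1 hz).2) ht h2)
  · by_cases h2 : int x y = y
    · exact Or.inr (Or.inr (h2 ▸ hx.mem_of_subset (fun z hz => (mem_int.1 hz).1) ht h1))
    · have h3 := hx.mem_of_subset (fun z hz => (mem_int.1 hz).1) ht h1
      have h4 := hy.mem_of_subset (fun z hz => (mem_int.1 hz).2) ht h2
      exact absurd (mem_int.2 ⟨h3, h4⟩) (not_mem_self _)

theorem IsOrd.subset_iff {x y : M} (hx : IsOrd x) (hy : IsOrd y) :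
    IsSubset x y ↔ x ∈ y ∨ x = y := by
  constructor
  · intro h
    rcases hx.trichotomy hy with h1 | h1 | h1
    · exact Or.inl h1
    · exact Or.inr h1
    · exact absurd (h _ h1) (not_mem_self _)
  · rintro (h | rfl)
    · exact hy.1 x h
    · exact fun _ h => h

theorem IsOrd.subset_or_mem {x y : M} (hx : IsOrd x) (hy : IsOrd y) : IsSubset x y ∨ y ∈ x := by
  rw [hx.subset_iff hy, or_assoc]
  exact hx.trichotomy hy

omit hM in
theorem IsSubset.trans {x y z : M} (h : IsSubset x y) (h' : IsSubset y z) : IsSubset x z :=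
  fun w hw => h' w (h w hw)

theorem isOrd_emp : IsOrd (emp : M) := ⟨fun y hy => absurd hy (not_mem_emp y),
  fun y _ hy => absurd hy (not_mem_emp y)⟩

theorem IsOrd.suc {x : M} (h : IsOrd x) : IsOrd (suc x) := by
  refine ⟨fun y hy z hz => ?_, fun y z hy hz => ?_⟩
  · rw [mem_suc] at hy ⊢
    rcases hy with rfl | hy
    · exact Or.inr hz
    · exact Or.inr (h.trans hy hz)
  · rw [mem_suc] at hy hz
    have hy' : IsOrd y := hy.elim (fun e => e ▸ h) h.of_mem
    have hz' : IsOrd z := hz.elim (fun e => e ▸ h) h.of_mem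
    exact hy'.trichotomy hz'

theorem suc_inj {x y : M} (h : suc x = suc y) : x = y := by
  have h1 : x ∈ suc y := h ▸ mem_suc.2 (Or.inl rfl)
  have h2 : y ∈ suc x := h ▸ mem_suc.2 (Or.inl rfl)
  rw [mem_suc] at h1 h2
  rcases h1 with h1 | h1
  · exact h1
  · rcases h2 with h2 | h2
    · exact h2.symm
    · exact absurd h1 (not_mem_of_mem h2)

theorem suc_ne_emp (x : M) : suc x ≠ emp := fun h =>
  not_mem_emp x (h ▸ mem_suc.2 (Or.inl rfl))

/-- Every ordinal is zero, a successor or a limit. -/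
theorem IsOrd.cases {x : M} (h : IsOrd x) : x = emp ∨ (∃ y, y ∈ x ∧ x = ZFModel.suc y) ∨ IsLimitOrd x := by
  by_cases h0 : x = emp
  · exact Or.inl h0
  refine Or.inr ?_
  by_cases h1 : ∀ y, y ∈ x → ∃ z, z ∈ x ∧ y ∈ z
  · exact Or.inr ⟨h, exists_mem_of_ne h0, h1⟩
  · push Not at h1
    obtain ⟨y, hy, hmax⟩ := h1
    refine Or.inl ⟨y, hy, set_ext fun z => ⟨fun hz => ?_, fun hz => ?_⟩⟩
    · rw [mem_suc]
      rcases h.2 z y hz hy with h2 | h2 | h2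
      · exact Or.inr h2
      · exact Or.inl h2
      · exact absurd h2 (hmax z hz)
    · rcases mem_suc.1 hz with rfl | hz
      · exact hy
      · exact h.trans hy hz

theorem not_isLimitOrd_suc (x : M) : ¬ IsLimitOrd (suc x) := by
  rintro ⟨-, -, h⟩
  obtain ⟨z, hz, hxz⟩ := h x (mem_suc.2 (Or.inl rfl))
  rcases mem_suc.1 hz with rfl | hz
  · exact not_mem_self _ hxz
  · exact not_mem_of_mem hz hxz

/-- The least ordinal with the property `P`. -/
noncomputable def least (P : M → Prop) : M := the fun a => IsOrd a ∧ P a ∧ ∀ b, b ∈ a → ¬ P b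

instance {P : (ℕ → M) → M → Prop} [h : Dfn (fun g => P (fun i => g (i + 1)) (g 0))] :
    Tm (fun g => least (fun x => P g x)) := by
  have h2 : Dfn (fun g => P (fun i => g (i + 2)) (g 0)) :=
    h.rename (fun i => Nat.casesOn i 0 (fun j => j + 2))
  have h3 : Dfn (fun g => P (fun i => g (i + 1)) (g 0)) := h
  unfold least
  exact Tm.the (P := fun g a => IsOrd a ∧ P g a ∧ ∀ b, b ∈ a → ¬ P g b)

/-- The substitute for choice: a witness among the ordinals is made canonical and depends definably
on the parameters. -/
theorem least_spec (P : M → Prop) [DPred P] {a : M} (ha : IsOrd a) (hP : P a) :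
    IsOrd (least P) ∧ P (least P) ∧ (∀ b, b ∈ least P → ¬ P b) ∧ IsSubset (least P) a := by
  obtain ⟨x, hx, hPx, hmin⟩ := exists_min_of_mem P (suc a) ⟨a, mem_suc.2 (Or.inl rfl), hP⟩
  have hx' := ha.suc.of_mem hx
  have hmin' : ∀ b, b ∈ x → ¬ P b := fun b hb hPb => hmin b (ha.suc.trans hx hb) hPb hb
  have : least P = x := by
    refine the_eq ⟨hx', hPx, hmin'⟩ fun z ⟨hz, hPz, hz'⟩ => ?_
    rcases hz.trichotomy hx' with h | h | h
    · exact absurd hPz (hmin' z h)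
    · exact h
    · exact absurd hPx (hz' x h)
  rw [this]
  refine ⟨hx', hPx, hmin', (hx'.subset_iff ha).2 ?_⟩
  exact (mem_suc.1 hx).symm

end Ordinals

/-! ### The set of natural numbers and induction. -/

section Omega

variable [hM : Fact (ModelsZF M)]

/-- The ordinals with no limit at or below them all lie in the inductive set `I`, by a minimal
counterexample; separated from `I` they form the first limit. -/
theorem exists_isOmega : ∃ o : M, IsOmega o := by
  obtain ⟨I, ⟨z, hz, hzI⟩, hI⟩ := hM.out.infinity
  rw [isEmptySet_eq] at hz
  subst hz
  have hI' : ∀ z, z ∈ I → suc z ∈ I := fun z hz => by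
    obtain ⟨s, hs, hsI⟩ := hI z hz
    rwa [isSucc_eq.1 hs] at hsI
  let N : M → Prop := fun x => IsOrd x ∧ ¬ IsLimitOrd x ∧ ∀ y, y ∈ x → ¬ IsLimitOrd y
  have hNmem : ∀ x y, N x → y ∈ x → N y := fun x y hx hy =>
    ⟨hx.1.of_mem hy, hx.2.2 y hy, fun z hz => hx.2.2 z (hx.1.trans hy hz)⟩
  have hNI : ∀ x, N x → x ∈ I := by
    intro x hx
    by_contra h
    obtain ⟨y, hy, ⟨hyI, hyN⟩, hmin⟩ := exists_min_of_mem
      (fun x => ¬ x ∈ I ∧ IsOrd x ∧ ¬ IsLimitOrd x ∧ ∀ y, y ∈ x → ¬ IsLimitOrd y) (suc x)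
      ⟨x, mem_suc.2 (Or.inl rfl), h, hx⟩
    have hyN : N y := hyN
    rcases hyN.1.cases with rfl | ⟨w, hw, rfl⟩ | hl
    · exact hyI hzI
    · by_cases hwI : w ∈ I
      · exact hyI (hI' w hwI)
      · exact hmin w (hx.1.suc.trans hy hw) ⟨hwI, hNmem _ _ hyN hw⟩ hw
    · exact hyN.2.1 hl
  let o : M := sep I fun x => IsOrd x ∧ ¬ IsLimitOrd x ∧ ∀ y, y ∈ x → ¬ IsLimitOrd y
  have ho : ∀ x, x ∈ o ↔ N x := fun x => by
    rw [mem_sep]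
    exact ⟨fun h => h.2, fun h => ⟨hNI x h, h⟩⟩
  refine ⟨o, ⟨⟨fun y hy z hz => ?_, fun y z hy hz => ?_⟩, ⟨emp, ?_⟩, fun y hy => ⟨suc y, ?_, ?_⟩⟩,
    fun x hx => ((ho x).1 hx).2.1⟩
  · exact (ho z).2 (hNmem y z ((ho y).1 hy) hz)
  · exact ((ho y).1 hy).1.trichotomy ((ho z).1 hz).1
  · exact (ho _).2 ⟨isOrd_emp, fun h => h.2.1.elim fun y hy => not_mem_emp y hy,
      fun y hy => absurd hy (not_mem_emp y)⟩
  · have hy := (ho y).1 hy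
    refine (ho _).2 ⟨hy.1.suc, not_isLimitOrd_suc y, fun z hz => ?_⟩
    rcases mem_suc.1 hz with rfl | hz
    · exact hy.2.1
    · exact hy.2.2 z hz
  · exact mem_suc.2 (Or.inl rfl)

theorem IsOmega.unique {o o' : M} (h : IsOmega o) (h' : IsOmega o') : o = o' := by
  rcases h.1.1.trichotomy h'.1.1 with h1 | h1 | h1
  · exact absurd h.1 (h'.2 o h1)
  · exact h1
  · exact absurd h'.1 (h.2 o' h1)

/-- `ω` -/
noncomputable def om : M := the IsOmega

theorem isOmega_om : IsOmega (om : M) := by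
  obtain ⟨o, ho⟩ := exists_isOmega (M := M)
  exact the_spec ⟨o, ho, fun _ h => h.unique ho⟩

theorem isOmega_eq {o : M} : IsOmega o ↔ o = om :=
  ⟨fun h => h.unique isOmega_om, fun h => h ▸ isOmega_om⟩

theorem isNat_iff {n : M} : IsNat n ↔ n ∈ (om : M) := by simp [IsNat, isOmega_eq]

theorem isOrd_om : IsOrd (om : M) := isOmega_om.1.1

theorem isOrd_of_nat {n : M} (h : n ∈ (om : M)) : IsOrd n := isOrd_om.of_mem h

theorem emp_mem_om : (emp : M) ∈ (om : M) := by
  rcases (isOrd_emp (M := M)).trichotomy isOrd_om with h | h | h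
  · exact h
  · obtain ⟨y, hy⟩ := (isOmega_om (M := M)).1.2.1
    rw [← h] at hy
    exact absurd hy (not_mem_emp y)
  · exact absurd h (not_mem_emp _)

theorem suc_mem_limit {l n : M} (hl : IsLimitOrd l) (h : n ∈ l) : suc n ∈ l := by
  obtain ⟨z, hz, hnz⟩ := hl.2.2 n h
  have hn : IsOrd n := hl.1.of_mem h
  have hz' : IsOrd z := hl.1.of_mem hz
  rcases hn.suc.trichotomy hz' with h1 | h1 | h1
  · exact hl.1.trans hz h1
  · exact h1 ▸ hz
  · rcases mem_suc.1 h1 with rfl | h2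
    · exact absurd hnz (not_mem_self _)
    · exact absurd hnz (not_mem_of_mem h2)

theorem suc_mem_om {n : M} (h : n ∈ (om : M)) : suc n ∈ (om : M) := suc_mem_limit isOmega_om.1 h

theorem nat_cases {n : M} (h : n ∈ (om : M)) : n = emp ∨ ∃ m, m ∈ (om : M) ∧ n = suc m := by
  rcases (isOrd_of_nat h).cases with h1 | ⟨m, hm, rfl⟩ | h1
  · exact Or.inl h1
  · exact Or.inr ⟨m, isOrd_om.trans h hm, rfl⟩
  · exact absurd h1 (isOmega_om.2 n h)

theorem nat_induction (P : M → Prop) [DPred P] (h0 : P emp)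
    (hs : ∀ n, n ∈ (om : M) → P n → P (suc n)) : ∀ n, n ∈ (om : M) → P n := by
  intro n hn
  by_contra h
  obtain ⟨m, hm, hPm, hmin⟩ := exists_min_of_mem (fun n => ¬ P n) om ⟨n, hn, h⟩
  rcases nat_cases hm with rfl | ⟨k, hk, rfl⟩
  · exact hPm h0
  · by_cases hPk : P k
    · exact hPm (hs k hk hPk)
    · exact hmin k hk hPk (mem_suc.2 (Or.inl rfl))

theorem nat_subset_or_mem {m n : M} (hm : m ∈ (om : M)) (hn : n ∈ (om : M)) :
    IsSubset m n ∨ n ∈ m := (isOrd_of_nat hm).subset_or_mem (isOrd_of_nat hn)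

/-- Any two natural numbers are bounded by a third. -/
theorem exists_nat_ub {m n : M} (hm : m ∈ (om : M)) (hn : n ∈ (om : M)) :
    ∃ k, k ∈ (om : M) ∧ m ∈ k ∧ n ∈ k := by
  rcases (isOrd_of_nat hm).trichotomy (isOrd_of_nat hn) with h | h | h
  · exact ⟨suc n, suc_mem_om hn, mem_suc.2 (Or.inr h), mem_suc.2 (Or.inl rfl)⟩
  · exact ⟨suc n, suc_mem_om hn, mem_suc.2 (Or.inl h), mem_suc.2 (Or.inl rfl)⟩
  · exact ⟨suc m, suc_mem_om hm, mem_suc.2 (Or.inl rfl), mem_suc.2 (Or.inr h)⟩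

/-- Induction for ordinals. -/
theorem ord_induction (P : M → Prop) [DPred P]
    (h : ∀ x, IsOrd x → (∀ y, y ∈ x → P y) → P x) : ∀ x, IsOrd x → P x := by
  intro x hx
  by_contra hPx
  obtain ⟨h1, h2, h3, -⟩ := least_spec (fun x => ¬ P x) hx hPx
  exact h2 (h _ h1 fun y hy => not_not.1 (h3 y hy))

end Omega

/-! ### Finite sets and their cardinalities. -/

section Finite

variable [hM : Fact (ModelsZF M)]

theorem isFin_iff {x : M} : IsFin x ↔ ∃ n, n ∈ (om : M) ∧ Equinum x n := by
  simp [IsFin, isNat_iff]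

theorem isCountablyInfinite_iff {x : M} : IsCountablyInfinite x ↔ Equinum x om := by
  simp [IsCountablyInfinite, isOmega_eq]

theorem equinum_emp {x : M} (h : Equinum x emp) : x = emp := by
  obtain ⟨F, _, h1, -, -⟩ := h.exists_fun
  exact eq_emp fun z hz => not_mem_emp _ (h1 z hz)

/-- Removing one element from each side preserves equinumerosity. -/
theorem Equinum.of_ins {a b s t : M} (h : Equinum (ins a s) (ins b t)) (ha : ¬ a ∈ s)
    (hb : ¬ b ∈ t) : Equinum s t := by
  classical
  obtain ⟨F, _, h1, h2, h3⟩ := h.exists_fun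
  have haa : a ∈ ins a s := mem_ins.2 (Or.inl rfl)
  have hs : ∀ x, x ∈ s → x ∈ ins a s := fun x hx => mem_ins.2 (Or.inr hx)
  -- The point sent to `b`, if it lies in `s`, is rerouted to `F a`. A definite description keeps
  -- the case distinction definable.
  let G : M → M := fun x => the fun y => (F x = b ∧ y = F a) ∨ (F x ≠ b ∧ y = F x)
  have hG : ∀ x, G x = if F x = b then F a else F x := by
    intro x
    by_cases h : F x = b
    · rw [if_pos h]
      exact the_eq (Or.inl ⟨h, rfl⟩) (by grind)
    · rw [if_neg h]
      exact the_eq (Or.inr ⟨h, rfl⟩) (by grind)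
  have h1' : ∀ x, x ∈ ins a s → F x = b ∨ F x ∈ t := fun x hx => mem_ins.1 (h1 x hx)
  refine equinum_of_fun G ?_ ?_ ?_
  · intro x hx
    rw [hG]
    have := h1' x (hs x hx)
    have := h1' a haa
    have := h2 x a (hs x hx) haa
    grind
  · intro x x' hx hx' he
    rw [hG, hG] at he
    have := h2 x a (hs x hx) haa
    have := h2 x' a (hs x' hx') haa
    have := h2 x x' (hs x hx) (hs x' hx')
    grind
  · intro y hy
    obtain ⟨x, hx, hxy⟩ := h3 y (mem_ins.2 (Or.inr hy))
    obtain ⟨x', hx', hxb⟩ := h3 b (mem_ins.2 (Or.inl rfl))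
    rw [mem_ins] at hx hx'
    rcases hx with rfl | hx
    · rcases hx' with rfl | hx'
      · exact absurd (hxy.trans hxb.symm ▸ hy) hb
      · exact ⟨x', hx', by rw [hG, if_pos hxb.symm, hxy]⟩
    · refine ⟨x, hx, ?_⟩
      rw [hG, if_neg, hxy]
      rw [← hxy]
      rintro rfl
      exact hb hy

theorem Equinum.ins {a b s t : M} (h : Equinum s t) (ha : ¬ a ∈ s) (hb : ¬ b ∈ t) :
    Equinum (ins a s) (ins b t) := by
  classical
  obtain ⟨F, _, h1, h2, h3⟩ := h.exists_fun
  let G : M → M := fun x => the fun y => (x = a ∧ y = b) ∨ (x ≠ a ∧ y = F x)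
  have hG : ∀ x, G x = if x = a then b else F x := by
    intro x
    by_cases h : x = a
    · rw [if_pos h]
      exact the_eq (Or.inl ⟨h, rfl⟩) (by grind)
    · rw [if_neg h]
      exact the_eq (Or.inr ⟨h, rfl⟩) (by grind)
  refine equinum_of_fun G ?_ ?_ ?_
  · intro x hx
    rw [hG, mem_ins]
    have := h1 x
    grind [mem_ins]
  · intro x x' hx hx' he
    rw [hG, hG] at he
    have := h1 x
    have := h1 x'
    have := h2 x x'
    grind [mem_ins]
  · intro y hy
    rcases mem_ins.1 hy with rfl | hy
    · exact ⟨a, mem_ins.2 (Or.inl rfl), by rw [hG, if_pos rfl]⟩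
    · obtain ⟨x, hx, rfl⟩ := h3 y hy
      refine ⟨x, mem_ins.2 (Or.inr hx), ?_⟩
      rw [hG, if_neg]
      rintro rfl
      exact ha hx

theorem isFin_emp : IsFin (emp : M) := isFin_iff.2 ⟨emp, emp_mem_om, Equinum.refl _⟩

theorem ins_eq_self {a s : M} (h : a ∈ s) : ins a s = s :=
  set_ext fun z => by rw [mem_ins]; exact ⟨fun h' => h'.elim (fun e => e ▸ h) id, Or.inr⟩

theorem IsFin.ins {s : M} (h : IsFin s) (a : M) : IsFin (ZFModel.ins a s) := by
  by_cases ha : a ∈ s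
  · rwa [ins_eq_self ha]
  · obtain ⟨n, hn, he⟩ := isFin_iff.1 h
    exact isFin_iff.2 ⟨suc n, suc_mem_om hn, he.ins ha (not_mem_self n)⟩

theorem exists_ins_of_equinum_suc {s n : M} (h : Equinum s (suc n)) :
    ∃ a t, ¬ a ∈ t ∧ s = ins a t ∧ Equinum t n := by
  obtain ⟨F, _, h1, h2, h3⟩ := h.exists_fun
  obtain ⟨a, ha, -⟩ := h3 n (mem_suc.2 (Or.inl rfl))
  have hs : s = ins a (sep s fun x => x ≠ a) := set_ext fun z => by
    rw [mem_ins, mem_sep]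
    grind
  have hat : ¬ a ∈ sep s fun x => x ≠ a := by simp
  exact ⟨a, _, hat, hs, (hs ▸ h : Equinum _ (ZFModel.ins n n)).of_ins hat (not_mem_self n)⟩

theorem fin_induction (P : M → Prop) [DPred P] (h0 : P emp)
    (hs : ∀ a s, IsFin s → ¬ a ∈ s → P s → P (ins a s)) : ∀ s, IsFin s → P s := by
  intro s hs'
  obtain ⟨n, hn, he⟩ := isFin_iff.1 hs'
  -- The induction is on the size, for all sets of that size at once.
  refine nat_induction (fun n => ∀ s, Equinum s n → P s) ?_ ?_ n hn s he
  · intro s h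
    rwa [equinum_emp h]
  · intro n hn ih s h
    obtain ⟨a, t, hat, rfl, ht⟩ := exists_ins_of_equinum_suc h
    exact hs a t (isFin_iff.2 ⟨n, hn, ht⟩) hat (ih t ht)

theorem subset_ins_cases {a s t : M} (h : IsSubset t (ins a s)) :
    IsSubset t s ∨ ∃ t', IsSubset t' s ∧ ¬ a ∈ t' ∧ t = ins a t' := by
  by_cases ha : a ∈ t
  · refine Or.inr ⟨sep t fun x => x ≠ a, fun z hz => ?_, by simp, set_ext fun z => ?_⟩
    · rw [mem_sep] at hz
      exact (mem_ins.1 (h z hz.1)).resolve_left hz.2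
    · rw [mem_ins, mem_sep]
      grind
  · refine Or.inl fun z hz => (mem_ins.1 (h z hz)).resolve_left ?_
    rintro rfl
    exact ha hz

theorem IsFin.subset {s t : M} (h : IsFin s) (ht : IsSubset t s) : IsFin t := by
  refine fin_induction (fun s => ∀ t, IsSubset t s → IsFin t) ?_ ?_ s h t ht
  · intro t ht
    rw [eq_emp fun z hz => not_mem_emp z (ht z hz)]
    exact isFin_emp
  · intro a s _ _ ih t ht
    rcases subset_ins_cases ht with h1 | ⟨t', h1, -, rfl⟩
    · exact ih t h1
    · exact (ih t' h1).ins a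

theorem IsFin.un {s t : M} (h : IsFin s) (ht : IsFin t) : IsFin (ZFModel.un s t) := by
  refine fin_induction (fun s => IsFin (ZFModel.un s t)) ?_ ?_ s h
  · exact ht.subset fun z hz => by simpa using hz
  · intro a s _ _ ih
    exact (ih.ins a).subset fun z hz => by simpa [or_assoc] using hz

theorem IsFin.bUn {s : M} (h : IsFin s) (F : M → M) [DFun F] (hF : ∀ x, x ∈ s → IsFin (F x)) :
    IsFin (bUn s F) := by
  refine fin_induction (fun s => (∀ x, x ∈ s → IsFin (F x)) → IsFin (ZFModel.bUn s fun x => F x))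
    ?_ ?_ s h hF
  · intro _
    exact isFin_emp.subset fun z hz => by simp at hz
  · intro a s _ _ ih hF
    refine ((hF a (mem_ins.2 (Or.inl rfl))).un (ih fun x hx => hF x (mem_ins.2 (Or.inr hx)))).subset ?_
    intro z hz
    simp only [mem_bUn, mem_ins, mem_un] at hz ⊢
    grind

theorem isFin_singleton (a : M) : IsFin (ins a emp) := isFin_emp.ins a

theorem IsFin.repl {s : M} (h : IsFin s) (F : M → M) [DFun F] : IsFin (repl s F) := by
  refine (h.bUn (fun x => ZFModel.ins (F x) emp) fun x _ => isFin_singleton _).subset fun z hz => ?_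
  simpa using hz

theorem IsFin.equinum {s t : M} (h : IsFin s) (he : Equinum s t) : IsFin t := by
  obtain ⟨n, hn, he'⟩ := isFin_iff.1 h
  exact isFin_iff.2 ⟨n, hn, he.symm.trans he'⟩

theorem isFin_nat {n : M} (h : n ∈ (om : M)) : IsFin n := isFin_iff.2 ⟨n, h, Equinum.refl n⟩

theorem IsFin.pow {s : M} (h : IsFin s) : IsFin (pow s) := by
  refine fin_induction (fun s => IsFin (ZFModel.pow s)) ?_ ?_ s h
  · refine (isFin_singleton emp).subset fun z hz => ?_
    rw [mem_pow] at hz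
    rw [mem_ins]
    exact Or.inl (eq_emp fun w hw => not_mem_emp w (hz w hw))
  · intro a s _ _ ih
    refine (ih.un (ih.repl fun t => ZFModel.ins a t)).subset fun z hz => ?_
    rw [mem_pow] at hz
    simp only [mem_un, mem_repl, mem_pow]
    rcases subset_ins_cases hz with h1 | ⟨t', h1, -, rfl⟩
    · exact Or.inl h1
    · exact Or.inr ⟨t', h1, rfl⟩

theorem nat_eq_of_equinum {m n : M} (hm : m ∈ (om : M)) (hn : n ∈ (om : M)) (h : Equinum m n) :
    m = n := by
  refine nat_induction (fun m => ∀ n, n ∈ (om : M) → Equinum m n → m = n) ?_ ?_ m hm n hn h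
  · exact fun n _ h => (equinum_emp h.symm).symm
  · intro _ _ ih n hn h
    rcases nat_cases hn with rfl | ⟨k, hk, rfl⟩
    · exact absurd (equinum_emp h) (suc_ne_emp _)
    · rw [ih k hk (Equinum.of_ins h (not_mem_self _) (not_mem_self k))]

/-- The number of elements of a finite set. -/
noncomputable def card (s : M) : M := the fun n => n ∈ (om : M) ∧ Equinum s n

instance {a : (ℕ → M) → M} [Tm a] : Tm (fun g => card (a g)) := by
  unfold card; infer_instance

theorem card_eq {s n : M} (hn : n ∈ (om : M)) (h : Equinum s n) : card s = n :=
  the_eq ⟨hn, h⟩ fun _ hm => nat_eq_of_equinum hm.1 hn (hm.2.symm.trans h)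

theorem IsFin.card_spec {s : M} (h : IsFin s) : card s ∈ (om : M) ∧ Equinum s (card s) := by
  obtain ⟨n, hn, he⟩ := isFin_iff.1 h
  rw [card_eq hn he]
  exact ⟨hn, he⟩

theorem card_ins {a s : M} (h : IsFin s) (ha : ¬ a ∈ s) : card (ins a s) = suc (card s) :=
  card_eq (suc_mem_om h.card_spec.1) (h.card_spec.2.ins ha (not_mem_self _))

theorem suc_subset_suc {m n : M} (h : IsSubset m n) (hm : IsOrd m) (hn : IsOrd n) :
    IsSubset (suc m) (suc n) := by
  intro z hz
  rw [mem_suc] at hz ⊢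
  rcases hz with rfl | hz
  · exact ((hm.subset_iff hn).1 h).symm
  · exact Or.inr (h z hz)

theorem card_mono {s t : M} (h : IsFin t) (hst : IsSubset s t) : IsSubset (card s) (card t) := by
  refine fin_induction (fun t => ∀ s, IsSubset s t → IsSubset (card s) (card t)) ?_ ?_ t h s hst
  · intro s hs
    rw [eq_emp fun z hz => not_mem_emp z (hs z hz)]
    exact fun _ h => h
  · intro a t ht hat ih s hs
    rw [card_ins ht hat]
    rcases subset_ins_cases hs with h1 | ⟨s', h1, has', rfl⟩
    · exact fun z hz => mem_suc.2 (Or.inr (ih s h1 z hz))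
    · have hs' := ht.subset h1
      rw [card_ins hs' has']
      exact suc_subset_suc (ih s' h1) (isOrd_of_nat hs'.card_spec.1) (isOrd_of_nat ht.card_spec.1)

theorem not_isFin_om : ¬ IsFin (om : M) := by
  intro h
  -- If `ω` had `m` elements, its subset `suc m` would have too many.
  have h1 := card_mono h (isOrd_om.1 _ (suc_mem_om h.card_spec.1))
  rw [card_eq (suc_mem_om h.card_spec.1) (Equinum.refl _)] at h1
  exact not_mem_self _ (h1 _ (mem_suc.2 (Or.inl rfl)))

theorem IsCountablyInfinite.not_isFin {x : M} (h : IsCountablyInfinite x) : ¬ IsFin x := fun h' =>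
  not_isFin_om (h'.equinum (isCountablyInfinite_iff.1 h))

/-- A set which is not finite has subsets of every finite cardinality. -/
theorem exists_subset_card {x n : M} (h : ¬ IsFin x) (hn : n ∈ (om : M)) :
    ∃ s, IsSubset s x ∧ Equinum s n := by
  refine nat_induction (fun n => ∃ s, IsSubset s x ∧ Equinum s n) ?_ ?_ n hn
  · exact ⟨emp, fun z hz => absurd hz (not_mem_emp z), Equinum.refl _⟩
  · rintro n hn ⟨s, hs, he⟩
    obtain ⟨a, ha, has⟩ : ∃ a, a ∈ x ∧ ¬ a ∈ s := by
      by_contra! h'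
      exact h ((isFin_iff.2 ⟨n, hn, he⟩).subset h')
    refine ⟨ins a s, fun z hz => ?_, he.ins has (not_mem_self n)⟩
    rcases mem_ins.1 hz with rfl | hz
    · exact ha
    · exact hs z hz

/-- A finite subset of the union of a directed class is a subset of one of its members. -/
theorem IsFin.subset_directed {s : M} (h : IsFin s) (Q : M → Prop) [DPred Q] (hne : ∃ b, Q b)
    (hdir : ∀ b c, Q b → Q c → ∃ d, Q d ∧ IsSubset b d ∧ IsSubset c d)
    (hs : ∀ x, x ∈ s → ∃ b, Q b ∧ x ∈ b) : ∃ b, Q b ∧ IsSubset s b := by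
  refine fin_induction (fun s => (∀ x, x ∈ s → ∃ b, Q b ∧ x ∈ b) → ∃ b, Q b ∧ IsSubset s b)
    ?_ ?_ s h hs
  · obtain ⟨b, hb⟩ := hne
    exact fun _ => ⟨b, hb, fun z hz => absurd hz (not_mem_emp z)⟩
  · intro a s _ _ ih hs
    obtain ⟨b, hb, hsb⟩ := ih fun x hx => hs x (mem_ins.2 (Or.inr hx))
    obtain ⟨c, hc, hac⟩ := hs a (mem_ins.2 (Or.inl rfl))
    obtain ⟨d, hd, hbd, hcd⟩ := hdir b c hb hc
    refine ⟨d, hd, fun z hz => ?_⟩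
    rcases mem_ins.1 hz with rfl | hz
    · exact hcd _ hac
    · exact hbd _ (hsb _ hz)

end Finite

/-! ### Recursion along the natural numbers. -/

section Iteration

variable [hM : Fact (ModelsZF M)]

/-- `R` is a set of pairs `(k, y)`, each justified by `y` being the `k`-th iterate of `F` at `x`. -/
def IsIterRel (F : M → M) (x R : M) : Prop :=
  ∀ i z, App R i z → (i = emp ∧ z = x) ∨ ∃ j w, i = suc j ∧ App R j w ∧ z = F w

instance {F : M → M} [DFun F] {a b : (ℕ → M) → M} [Tm a] [Tm b] :
    Dfn (fun g => IsIterRel F (a g) (b g)) := by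
  unfold IsIterRel; infer_instance

/-- The `k`-th iterate of the class function `F` at `x`, for `k ∈ ω`. -/
noncomputable def iter (F : M → M) (x k : M) : M := the fun y => ∃ R, IsIterRel F x R ∧ App R k y

instance {F : M → M} [DFun F] {a b : (ℕ → M) → M} [Tm a] [Tm b] :
    Tm (fun g => iter F (a g) (b g)) := by
  unfold iter; infer_instance

theorem IsIterRel.unique {F : M → M} [DFun F] {x : M} : ∀ k, k ∈ (om : M) → ∀ R R' y y',
    IsIterRel F x R → IsIterRel F x R' → App R k y → App R' k y' → y = y' := by
  refine nat_induction _ ?_ ?_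
  · intro R R' y y' hR hR' h h'
    rcases hR _ _ h with ⟨-, rfl⟩ | ⟨j, w, hj, -⟩
    · rcases hR' _ _ h' with ⟨-, rfl⟩ | ⟨j, w, hj, -⟩
      · rfl
      · exact absurd hj.symm (suc_ne_emp j)
    · exact absurd hj.symm (suc_ne_emp j)
  · intro k _ ih R R' y y' hR hR' h h'
    rcases hR _ _ h with ⟨hj, -⟩ | ⟨j, w, hj, hw, rfl⟩
    · exact absurd hj (suc_ne_emp k)
    · rcases hR' _ _ h' with ⟨hj', -⟩ | ⟨j', w', hj', hw', rfl⟩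
      · exact absurd hj' (suc_ne_emp k)
      · rw [← suc_inj hj] at hw
        rw [← suc_inj hj'] at hw'
        rw [ih R R' w w' hR hR' hw hw']

/-- Old justifications survive when `R` grows, so computations extend one pair at a time. -/
theorem IsIterRel.ins {F : M → M} {x R : M} (hR : IsIterRel F x R) {i z : M}
    (h : (i = emp ∧ z = x) ∨ ∃ j w, i = suc j ∧ App R j w ∧ z = F w) :
    IsIterRel F x (ins (opair i z) R) := by
  intro i' z' h'
  have key : (i' = emp ∧ z' = x) ∨ ∃ j w, i' = suc j ∧ App R j w ∧ z' = F w := by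
    rcases app_ins.1 h' with ⟨rfl, rfl⟩ | h'
    · exact h
    · exact hR _ _ h'
  rcases key with h1 | ⟨j, w, h1, h2, h3⟩
  · exact Or.inl h1
  · exact Or.inr ⟨j, w, h1, app_ins.2 (Or.inr h2), h3⟩

theorem IsIterRel.exists (F : M → M) [DFun F] (x : M) : ∀ k, k ∈ (om : M) →
    ∃ y R, IsIterRel F x R ∧ App R k y := by
  have h0 : IsIterRel F x emp := fun i z h => absurd (app_iff.1 h) (not_mem_emp _)
  refine nat_induction _ ?_ ?_
  · exact ⟨x, _, h0.ins (Or.inl ⟨rfl, rfl⟩), app_ins.2 (Or.inl ⟨rfl, rfl⟩)⟩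
  · rintro k _ ⟨y, R, hR, hy⟩
    exact ⟨F y, _, hR.ins (Or.inr ⟨k, y, rfl, hy, rfl⟩), app_ins.2 (Or.inl ⟨rfl, rfl⟩)⟩

theorem iter_eq {F : M → M} [DFun F] {x k y R : M} (hk : k ∈ (om : M)) (hR : IsIterRel F x R)
    (h : App R k y) : iter F x k = y :=
  the_eq ⟨R, hR, h⟩ fun _ ⟨_, hR', h'⟩ => IsIterRel.unique k hk _ _ _ _ hR' hR h' h

theorem iter_zero (F : M → M) [DFun F] (x : M) : iter F x emp = x := by
  have h0 : IsIterRel F x emp := fun i z h => absurd (app_iff.1 h) (not_mem_emp _)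
  exact iter_eq emp_mem_om (h0.ins (Or.inl ⟨rfl, rfl⟩)) (app_ins.2 (Or.inl ⟨rfl, rfl⟩))

theorem iter_suc (F : M → M) [DFun F] (x : M) {k : M} (hk : k ∈ (om : M)) :
    iter F x (suc k) = F (iter F x k) := by
  obtain ⟨y, R, hR, hy⟩ := IsIterRel.exists F x k hk
  rw [iter_eq hk hR hy]
  exact iter_eq (suc_mem_om hk) (hR.ins (Or.inr ⟨k, y, rfl, hy, rfl⟩))
    (app_ins.2 (Or.inl ⟨rfl, rfl⟩))

end Iteration

/-! ### Countability without choice. -/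

section Countable

variable [hM : Fact (ModelsZF M)]

/-- Closure under predecessors makes `J` transitive, and a transitive proper subset of an ordinal is
an element of it. -/
theorem subset_om_of_pred_closed {J : M} (hJ : IsSubset J om)
    (hp : ∀ k, k ∈ (om : M) → suc k ∈ J → k ∈ J) : J = om ∨ J ∈ (om : M) := by
  by_cases h : J = om
  · exact Or.inl h
  refine Or.inr (isOrd_om.mem_of_subset hJ ?_ h)
  have h1 : ∀ k, k ∈ (om : M) → k ∈ J → IsSubset k J := by
    refine nat_induction _ ?_ ?_
    · exact fun _ z hz => absurd hz (not_mem_emp z)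
    · intro k hk ih hkJ z hz
      rcases mem_suc.1 hz with rfl | hz
      · exact hp _ hk hkJ
      · exact ih (hp _ hk hkJ) z hz
  exact fun z hz => h1 z (hJ z hz) hz

/-- A definable linear order of a set with all proper initial segments finite has order type at
most `ω`. -/
theorem fin_or_countablyInfinite_of_order {X : M} (lt : M → M → Prop) [DRel lt]
    (irrefl : ∀ x, ¬ lt x x) (trans : ∀ x y z, lt x y → lt y z → lt x z)
    (total : ∀ x y, x ∈ X → y ∈ X → lt x y ∨ x = y ∨ lt y x)
    (hfin : ∀ y, y ∈ X → IsFin (sep X fun x => lt x y)) :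
    IsFin X ∨ IsCountablyInfinite X := by
  -- The rank of `x` is the number of its predecessors; it embeds `X` into `ω`.
  have hmono : ∀ x y, x ∈ X → y ∈ X → lt x y →
      card (sep X fun z => lt z x) ∈ card (sep X fun z => lt z y) := by
    intro x y hx hy hxy
    have h1 : ¬ x ∈ sep X fun z => lt z x := fun h => irrefl x (mem_sep.1 h).2
    have h2 : IsSubset (ins x (sep X fun z => lt z x)) (sep X fun z => lt z y) := by
      intro z hz
      rcases mem_ins.1 hz with rfl | hz
      · exact mem_sep.2 ⟨hx, hxy⟩
      · exact mem_sep.2 ⟨(mem_sep.1 hz).1, trans _ _ _ (mem_sep.1 hz).2 hxy⟩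
    have h3 := card_mono (hfin y hy) h2
    rw [card_ins (hfin x hx) h1] at h3
    exact h3 _ (mem_suc.2 (Or.inl rfl))
  have hmax : ∀ s, IsFin s → IsSubset s X → s = emp ∨ ∃ m, m ∈ s ∧ ∀ z, z ∈ s → z = m ∨ lt z m := by
    refine fin_induction _ (fun _ => Or.inl rfl) ?_
    intro a s _ _ ih hs
    refine Or.inr ?_
    rcases ih fun z hz => hs z (mem_ins.2 (Or.inr hz)) with rfl | ⟨m, hm, hmax⟩
    · exact ⟨a, mem_ins.2 (Or.inl rfl), fun z hz =>
        Or.inl ((mem_ins.1 hz).resolve_right (not_mem_emp z))⟩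
    · rcases total a m (hs a (mem_ins.2 (Or.inl rfl))) (hs m (mem_ins.2 (Or.inr hm))) with h | h | h
      · exact ⟨m, mem_ins.2 (Or.inr hm), fun z hz => (mem_ins.1 hz).elim
          (fun e => Or.inr (e ▸ h)) (hmax z)⟩
      · exact ⟨m, mem_ins.2 (Or.inr hm), fun z hz => (mem_ins.1 hz).elim
          (fun e => Or.inl (e.trans h)) (hmax z)⟩
      · refine ⟨a, mem_ins.2 (Or.inl rfl), fun z hz => (mem_ins.1 hz).elim Or.inl fun hz => ?_⟩
        rcases hmax z hz with rfl | h'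
        · exact Or.inr h
        · exact Or.inr (trans _ _ _ h' h)
  have heq : Equinum X (repl X fun x => card (sep X fun z => lt z x)) := by
    refine equinum_repl _ fun x x' hx hx' he => ?_
    have he : card (sep X fun z => lt z x) = card (sep X fun z => lt z x') := he
    rcases total x x' hx hx' with h | h | h
    · exact absurd (he ▸ hmono x x' hx hx' h) (not_mem_self _)
    · exact h
    · exact absurd (he ▸ hmono x' x hx' hx h) (not_mem_self _)
  -- The ranks are closed under predecessors: the maximum of the segment below `x` has rank one
  -- less.
  have hJ : (repl X fun x => card (sep X fun z => lt z x)) = om ∨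
      (repl X fun x => card (sep X fun z => lt z x)) ∈ (om : M) := by
    refine subset_om_of_pred_closed ?_ ?_
    · intro z hz
      obtain ⟨x, hx, rfl⟩ := mem_repl.1 hz
      exact (hfin x hx).card_spec.1
    · intro k hk h
      obtain ⟨x, hx, hkx⟩ := mem_repl.1 h
      rcases hmax _ (hfin x hx) (fun z hz => (mem_sep.1 hz).1) with h0 | ⟨m, hm, hmm⟩
      · rw [h0, card_eq emp_mem_om (Equinum.refl _)] at hkx
        exact absurd hkx (suc_ne_emp k)
      · have hmX := mem_sep.1 hm
        have h1 : ¬ m ∈ sep X fun z => lt z m := fun h => irrefl m (mem_sep.1 h).2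
        have h2 : (sep X fun z => lt z x) = ins m (sep X fun z => lt z m) := by
          refine set_ext fun z => ?_
          simp only [mem_ins, mem_sep]
          constructor
          · intro hz
            exact (hmm z (mem_sep.2 hz)).imp_right fun h => ⟨hz.1, h⟩
          · rintro (rfl | hz)
            · exact hmX
            · exact ⟨hz.1, trans _ _ _ hz.2 hmX.2⟩
        rw [h2, card_ins (hfin m hmX.1) h1] at hkx
        exact mem_repl.2 ⟨m, hmX.1, suc_inj hkx⟩
  rcases hJ with h | h
  · exact Or.inr (isCountablyInfinite_iff.2 (h ▸ heq))
  · exact Or.inl (isFin_iff.2 ⟨_, h, heq⟩)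

/-- A set of ordinals covered by a definable sequence of finite sets is finite or countable. -/
theorem fin_or_countablyInfinite_of_cover {X : M} (hX : ∀ x, x ∈ X → IsOrd x) (E : M → M) [DFun E]
    (hE : ∀ k, k ∈ (om : M) → IsFin (E k)) (hc : ∀ x, x ∈ X → ∃ k, k ∈ (om : M) ∧ x ∈ E k) :
    IsFin X ∨ IsCountablyInfinite X := by
  have hr : ∀ x, x ∈ X → (least fun k => x ∈ E k) ∈ (om : M) ∧ x ∈ E (least fun k => x ∈ E k) := by
    intro x hx
    obtain ⟨k, hk, hxk⟩ := hc x hx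
    obtain ⟨h1, h2, -, h4⟩ := least_spec (fun k => x ∈ E k) (isOrd_of_nat hk) hxk
    refine ⟨?_, h2⟩
    rcases (h1.subset_iff (isOrd_of_nat hk)).1 h4 with h | h
    · exact isOrd_om.trans hk h
    · exact h ▸ hk
  -- First index of appearance, then the order of ordinals. The `IsOrd` clauses give transitivity on
  -- all of `M`, not only on `X`.
  refine fin_or_countablyInfinite_of_order (fun x y => (IsOrd (least fun k => y ∈ E k) ∧
    (least fun k => x ∈ E k) ∈ (least fun k => y ∈ E k)) ∨
    ((least fun k => x ∈ E k) = (least fun k => y ∈ E k) ∧ IsOrd y ∧ x ∈ y)) ?_ ?_ ?_ ?_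
  · rintro x (⟨-, h⟩ | ⟨-, -, h⟩) <;> exact not_mem_self _ h
  · rintro x y z (⟨h1, h2⟩ | ⟨h1, h2, h3⟩) (⟨h4, h5⟩ | ⟨h4, h5, h6⟩)
    · exact Or.inl ⟨h4, h4.trans h5 h2⟩
    · exact Or.inl ⟨h4 ▸ h1, h4 ▸ h2⟩
    · exact Or.inl ⟨h4, h1 ▸ h5⟩
    · exact Or.inr ⟨h1.trans h4, h5, h5.trans h6 h3⟩
  · intro x y hx hy
    have hx1 := isOrd_of_nat (hr x hx).1
    have hy1 := isOrd_of_nat (hr y hy).1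
    rcases hx1.trichotomy hy1 with h | h | h
    · exact Or.inl (Or.inl ⟨hy1, h⟩)
    · rcases (hX x hx).trichotomy (hX y hy) with h' | h' | h'
      · exact Or.inl (Or.inr ⟨h, hX y hy, h'⟩)
      · exact Or.inr (Or.inl h')
      · exact Or.inr (Or.inr (Or.inr ⟨h.symm, hX x hx, h'⟩))
    · exact Or.inr (Or.inr (Or.inl ⟨hx1, h⟩))
  · intro y hy
    have hry := (hr y hy).1
    refine ((isFin_nat (suc_mem_om hry)).bUn E fun k hk =>
      hE k (isOrd_om.trans (suc_mem_om hry) hk)).subset fun x hx => ?_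
    rw [mem_sep] at hx
    refine mem_bUn.2 ⟨least fun k => x ∈ E k, mem_suc.2 ?_, (hr x hx.1).2⟩
    rcases hx.2 with ⟨-, h⟩ | ⟨h, -⟩
    · exact Or.inr h
    · exact Or.inl h

/-- A finite or countable set is the union of a definable increasing sequence of finite sets. -/
theorem exists_cover {X : M} (h : IsFin X ∨ IsCountablyInfinite X) :
    ∃ E : M → M, DFun E ∧ (∀ k, k ∈ (om : M) → IsFin (E k)) ∧ (∀ k, IsSubset (E k) X) ∧
      (∀ j k, IsSubset j k → IsSubset (E j) (E k)) ∧
      ∀ x, x ∈ X → ∃ k, k ∈ (om : M) ∧ x ∈ E k := by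
  obtain ⟨o, ho, he⟩ : ∃ o, IsSubset o (om : M) ∧ Equinum X o := by
    rcases h with h | h
    · exact ⟨_, isOrd_om.1 _ h.card_spec.1, h.card_spec.2⟩
    · exact ⟨om, fun _ h => h, isCountablyInfinite_iff.1 h⟩
  obtain ⟨F, _, h1, h2, -⟩ := he.exists_fun
  refine ⟨fun k => sep X fun x => F x ∈ k, inferInstance, fun k hk => ?_,
    fun k z hz => (mem_sep.1 hz).1, fun j k hjk z hz => ?_, fun x hx => ?_⟩
  · have h3 : Equinum (sep X fun x => F x ∈ k) (repl (sep X fun x => F x ∈ k) F) :=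
      equinum_repl F fun x x' hx hx' => h2 x x' (mem_sep.1 hx).1 (mem_sep.1 hx').1
    refine ((isFin_nat hk).subset fun z hz => ?_).equinum h3.symm
    obtain ⟨x, hx, rfl⟩ := mem_repl.1 hz
    exact (mem_sep.1 hx).2
  · rw [mem_sep] at hz ⊢
    exact ⟨hz.1, hjk _ hz.2⟩
  · exact ⟨suc (F x), suc_mem_om (ho _ (h1 x hx)), mem_sep.2 ⟨hx, mem_suc.2 (Or.inl rfl)⟩⟩

end Countable

/-! ### The first uncountable ordinal, and ordinals as non-successor plus natural number. -/

section OmegaOne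

variable [hM : Fact (ModelsZF M)]

theorem IsOmega1.ord_of_mem {w x : M} (hw : IsOmega1 w) (hx : x ∈ w) : IsOrd x := hw.1.of_mem hx

/-- A definable sequence of finite sets does not cover `ω₁`. -/
theorem IsOmega1.not_cover {w : M} (hw : IsOmega1 w) (E : M → M) [DFun E]
    (hE : ∀ k, k ∈ (om : M) → IsFin (E k)) : ¬ ∀ x, x ∈ w → ∃ k, k ∈ (om : M) ∧ x ∈ E k := fun h =>
  hw.2.1 (fin_or_countablyInfinite_of_cover (fun _ hx => hw.ord_of_mem hx) E hE h)

theorem IsOmega1.suc_mem {w x : M} (hw : IsOmega1 w) (hx : x ∈ w) : suc x ∈ w := by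
  have hxo := hw.ord_of_mem hx
  rcases hxo.suc.trichotomy hw.1 with h | h | h
  · exact h
  -- If `suc x` were `ω₁`, a cover of `x` by finite sets, with `x` added to each, would cover `ω₁`.
  · obtain ⟨E, _, h1, -, -, h4⟩ := exists_cover (hw.2.2 x hx)
    refine absurd ?_ (hw.not_cover (fun k => ins x (E k)) fun k hk => (h1 k hk).ins x)
    intro y hy
    rw [← h, mem_suc] at hy
    rcases hy with rfl | hy
    · exact ⟨emp, emp_mem_om, mem_ins.2 (Or.inl rfl)⟩
    · obtain ⟨k, hk, hyk⟩ := h4 y hy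
      exact ⟨k, hk, mem_ins.2 (Or.inr hyk)⟩
  · rcases mem_suc.1 h with rfl | h
    · exact absurd hx (not_mem_self _)
    · exact absurd hx (not_mem_of_mem h)

theorem IsOmega1.emp_mem {w : M} (hw : IsOmega1 w) : (emp : M) ∈ w := by
  rcases isOrd_emp.trichotomy hw.1 with h | h | h
  · exact h
  · exact absurd (Or.inl (h ▸ isFin_emp)) hw.2.1
  · exact absurd h (not_mem_emp _)

theorem IsOmega1.mem_of_subset {w x y : M} (hw : IsOmega1 w) (hx : IsOrd x) (hy : y ∈ w)
    (h : IsSubset x y) : x ∈ w := by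
  rcases (hx.subset_iff (hw.ord_of_mem hy)).1 h with h | rfl
  · exact hw.1.trans hy h
  · exact hy

theorem IsOmega1.exists_ub {w x y : M} (hw : IsOmega1 w) (hx : x ∈ w) (hy : y ∈ w) :
    ∃ z, z ∈ w ∧ IsSubset x z ∧ IsSubset y z := by
  rcases (hw.ord_of_mem hx).subset_or_mem (hw.ord_of_mem hy) with h | h
  · exact ⟨y, hy, h, fun _ h => h⟩
  · exact ⟨x, hx, fun _ h => h, (hw.ord_of_mem hx).1 y h⟩

/-- Finitely many bounded subsets of `ω₁` have a common bound. -/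
theorem IsOmega1.exists_ub_of_fin {w s : M} (hw : IsOmega1 w) (hs : IsFin s)
    (h : ∀ y, y ∈ s → ∃ z, z ∈ w ∧ IsSubset y z) : ∃ z, z ∈ w ∧ ∀ y, y ∈ s → IsSubset y z := by
  refine fin_induction (fun s => (∀ y, y ∈ s → ∃ z, z ∈ w ∧ IsSubset y z) →
    ∃ z, z ∈ w ∧ ∀ y, y ∈ s → IsSubset y z) ?_ ?_ s hs h
  · exact fun _ => ⟨emp, hw.emp_mem, fun y hy => absurd hy (not_mem_emp y)⟩
  · intro a s _ _ ih h
    obtain ⟨z, hz, hsz⟩ := ih fun y hy => h y (mem_ins.2 (Or.inr hy))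
    obtain ⟨z', hz', haz'⟩ := h a (mem_ins.2 (Or.inl rfl))
    obtain ⟨z'', hz'', h1, h2⟩ := hw.exists_ub hz hz'
    refine ⟨z'', hz'', fun y hy => ?_⟩
    rcases mem_ins.1 hy with rfl | hy
    · exact haz'.trans h2
    · exact (hsz y hy).trans h1

theorem iter_mem {w x : M} (F : M → M) [DFun F] (hx : x ∈ w) (hF : ∀ y, y ∈ w → F y ∈ w) :
    ∀ k, k ∈ (om : M) → iter F x k ∈ w := by
  refine nat_induction _ ?_ ?_
  · rwa [iter_zero]
  · intro k hk ih
    rw [iter_suc F x hk]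
    exact hF _ ih

/-- `x` is not a successor. -/
def NotSucc (x : M) : Prop := ∀ y, x ≠ suc y

instance {a : (ℕ → M) → M} [Tm a] : Dfn (fun g => NotSucc (a g)) := by
  unfold NotSucc; infer_instance

instance : DFun (suc : M → M) := ⟨(inferInstance : Dfn fun g : ℕ → M => g 0 = suc (g 1))⟩

/-- The ordinal sum `x + k` for `k ∈ ω`. -/
noncomputable def addNat (x k : M) : M := iter suc x k

instance {a b : (ℕ → M) → M} [Tm a] [Tm b] : Tm (fun g => addNat (a g) (b g)) := by
  unfold addNat
  infer_instance

theorem addNat_zero (x : M) : addNat x emp = x := iter_zero suc x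

theorem addNat_suc (x : M) {k : M} (hk : k ∈ (om : M)) : addNat x (suc k) = suc (addNat x k) :=
  iter_suc suc x hk

/-- Successors are cancelled on both sides; a non-successor base forces them to run out together. -/
theorem addNat_inj {x y : M} (hx : NotSucc x) (hy : NotSucc y) : ∀ k, k ∈ (om : M) → ∀ j,
    j ∈ (om : M) → addNat x k = addNat y j → x = y ∧ k = j := by
  refine nat_induction _ ?_ ?_
  · intro j hj h
    rcases nat_cases hj with rfl | ⟨i, hi, rfl⟩
    · rw [addNat_zero, addNat_zero] at h
      exact ⟨h, rfl⟩
    · rw [addNat_zero, addNat_suc _ hi] at h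
      exact absurd h (hx _)
  · intro k hk ih j hj h
    rcases nat_cases hj with rfl | ⟨i, hi, rfl⟩
    · rw [addNat_zero, addNat_suc _ hk] at h
      exact absurd h.symm (hy _)
    · rw [addNat_suc _ hk, addNat_suc _ hi] at h
      obtain ⟨rfl, rfl⟩ := ih i hi (suc_inj h)
      exact ⟨rfl, rfl⟩

theorem exists_addNat : ∀ x : M, IsOrd x → ∃ l k, NotSucc l ∧ IsSubset l x ∧ IsOrd l ∧
    k ∈ (om : M) ∧ x = addNat l k := by
  refine ord_induction _ fun x hx ih => ?_
  rcases hx.cases with rfl | ⟨y, hy, rfl⟩ | hl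
  · exact ⟨emp, emp, fun y h => suc_ne_emp y h.symm, fun _ h => h, hx, emp_mem_om,
      (addNat_zero _).symm⟩
  · obtain ⟨l, k, h1, h2, h3, h4, h5⟩ := ih y hy
    refine ⟨l, suc k, h1, h2.trans (hx.1 y hy), h3, suc_mem_om h4, ?_⟩
    rw [addNat_suc _ h4, ← h5]
  · exact ⟨x, emp, fun y h => not_isLimitOrd_suc y (h ▸ hl), fun _ h => h, hx, emp_mem_om,
      (addNat_zero _).symm⟩

theorem addNat_mono {x y : M} (hy : IsOrd y) (h : x ∈ y) : ∀ k, k ∈ (om : M) →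
    IsOrd (addNat y k) ∧ addNat x k ∈ addNat y k := by
  refine nat_induction _ ?_ ?_
  · rw [addNat_zero, addNat_zero]
    exact ⟨hy, h⟩
  · rintro k hk ⟨h1, h2⟩
    rw [addNat_suc _ hk, addNat_suc _ hk]
    refine ⟨h1.suc, ?_⟩
    have h3 := h1.of_mem h2
    rw [mem_suc]
    rcases h3.suc.trichotomy h1 with h4 | h4 | h4
    · exact Or.inr h4
    · exact Or.inl h4
    · rcases mem_suc.1 h4 with h5 | h5
      · exact absurd (h5 ▸ h2) (not_mem_self _)
      · exact absurd h5 (not_mem_of_mem h2)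

theorem cardLT_two_of_subsingleton {n c : M} (hn : IsTwo n)
    (h : ∀ x y, x ∈ c → y ∈ c → x = y) : CardLT c n := by
  obtain ⟨z, i, hz, hi, hn⟩ := hn
  rw [isEmptySet_eq] at hz
  subst hz
  by_cases hc : c = emp
  · exact ⟨emp, (hn _).2 (Or.inl rfl), hc ▸ Equinum.refl _⟩
  · obtain ⟨a, ha⟩ := exists_mem_of_ne hc
    refine ⟨i, (hn _).2 (Or.inr rfl), ?_⟩
    have h1 : c = ins a emp := set_ext fun x => by
      rw [mem_ins]
      exact ⟨fun hx => Or.inl (h x a hx ha), fun hx => (hx.resolve_right (not_mem_emp x)) ▸ ha⟩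
    have h2 : i = ins emp emp := set_ext fun x => by
      rw [hi x, mem_ins]
      simp
    rw [h1, h2]
    exact (Equinum.refl emp).ins (not_mem_emp a) (not_mem_emp emp)

theorem IsOmega1.fin_or_countablyInfinite_of_subset {w x y : M} (hw : IsOmega1 w) (hy : y ∈ w)
    (h : IsSubset x y) : IsFin x ∨ IsCountablyInfinite x := by
  obtain ⟨E, _, h1, -, -, h4⟩ := exists_cover (hw.2.2 y hy)
  exact fin_or_countablyInfinite_of_cover (fun z hz => (hw.ord_of_mem hy).of_mem (h z hz)) E h1
    fun z hz => h4 z (h z hz)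

end OmegaOne

/-! ### The grid of rows and columns, and regularity from essential disjointness. -/

section Singular

variable [hM : Fact (ModelsZF M)]

/-- The columns `{l + k | l ∈ G k a non-successor}`. -/
noncomputable def column (G : M → M) (k : M) : M := repl (sep (G k) fun l => NotSucc l) fun l => addNat l k

instance {G : M → M} [DFun G] {a : (ℕ → M) → M} [Tm a] : Tm (fun g => column G (a g)) := by
  unfold column; infer_instance

theorem mem_column {G : M → M} {k x : M} :
    x ∈ column G k ↔ ∃ l, (l ∈ G k ∧ NotSucc l) ∧ x = addNat l k := by
  simp [column]

/-- The rows `{l + k | k ∈ ω}`. -/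
noncomputable def row (l : M) : M := repl om fun k => addNat l k

instance {a : (ℕ → M) → M} [Tm a] : Tm (fun g => row (a g)) := by
  unfold row; infer_instance

theorem mem_row {l x : M} : x ∈ row l ↔ ∃ k, k ∈ (om : M) ∧ x = addNat l k := by
  simp [row]

theorem row_countablyInfinite {l : M} (hl : NotSucc l) : IsCountablyInfinite (row l) :=
  isCountablyInfinite_iff.2 (equinum_repl (fun k => addNat l k) fun k j hk hj h =>
    (addNat_inj hl hl k hk j hj h).2).symm

/-- The countably infinite ones among the columns and rows. -/
noncomputable def grid (w : M) (G : M → M) : M := sep (pow w) fun A => IsCountablyInfinite A ∧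
  ((∃ k, k ∈ (om : M) ∧ A = column G k) ∨ ∃ l, l ∈ w ∧ NotSucc l ∧ A = row l)

theorem mem_grid {w : M} {G : M → M} [DFun G] {A : M} : A ∈ grid w G ↔ IsSubset A w ∧
    IsCountablyInfinite A ∧
    ((∃ k, k ∈ (om : M) ∧ A = column G k) ∨ ∃ l, l ∈ w ∧ NotSucc l ∧ A = row l) := by
  rw [grid, mem_sep, mem_pow]

/-- By uniqueness of `l + k`, distinct rows are disjoint, distinct columns are disjoint, and a row
and a column share at most one point. -/
theorem grid_almostDisjoint {n w : M} (hn : IsTwo n) (G : M → M) [DFun G] :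
    AlmostDisjoint n (grid w G) := by
  intro A B hA hB hne
  refine ⟨int A B, isInter_eq.2 rfl, cardLT_two_of_subsingleton hn fun x y hx hy => ?_⟩
  rw [mem_int] at hx hy
  have hcr : ∀ k l x, k ∈ (om : M) → NotSucc l → x ∈ column G k → x ∈ row l → x = addNat l k := by
    intro k l x hk hl h h'
    obtain ⟨l', ⟨-, hl'⟩, rfl⟩ := mem_column.1 h
    obtain ⟨j, hj, he⟩ := mem_row.1 h'
    rw [(addNat_inj hl' hl k hk j hj he).1]
  rcases (mem_grid.1 hA).2.2 with ⟨k, hk, rfl⟩ | ⟨l, hl, hls, rfl⟩ <;>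
    rcases (mem_grid.1 hB).2.2 with ⟨k', hk', rfl⟩ | ⟨l', hl', hls', rfl⟩
  · obtain ⟨l, ⟨-, hl⟩, rfl⟩ := mem_column.1 hx.1
    obtain ⟨l', ⟨-, hl'⟩, he⟩ := mem_column.1 hx.2
    exact absurd (by rw [(addNat_inj hl hl' k hk k' hk' he).2]) hne
  · rw [hcr k l' x hk hls' hx.1 hx.2, hcr k l' y hk hls' hy.1 hy.2]
  · rw [hcr k' l x hk' hls hx.2 hx.1, hcr k' l y hk' hls hy.2 hy.1]
  · obtain ⟨k, hk, rfl⟩ := mem_row.1 hx.1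
    obtain ⟨k', hk', he⟩ := mem_row.1 hx.2
    exact absurd (by rw [(addNat_inj hls hls' k hk k' hk' he).1]) hne

/-- If `ω₁` is the union of an increasing definable sequence of bounded sets, then the family
`grid` is not essentially disjoint. -/
theorem grid_not_essentiallyDisjoint {w : M} (hw : IsOmega1 w) (G : M → M) [DFun G]
    (hmono : ∀ j k, IsSubset j k → IsSubset (G j) (G k))
    (hbd : ∀ k, k ∈ (om : M) → ∃ z, z ∈ w ∧ IsSubset (G k) z)
    (hcov : ∀ x, x ∈ w → ∃ k, k ∈ (om : M) ∧ x ∈ G k) : ¬ EssentiallyDisjoint (grid w G) := by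
  rintro ⟨f, hf, hfin, hdisj⟩
  have haw : ∀ x k, x ∈ w → k ∈ (om : M) → addNat x k ∈ w := fun x k hx hk =>
    iter_mem suc hx (fun y hy => hw.suc_mem hy) k hk
  have hcol : ∀ k, k ∈ (om : M) → IsSubset (column G k) w ∧
      (IsFin (column G k) ∨ IsCountablyInfinite (column G k)) := by
    intro k hk
    obtain ⟨z, hz, hGz⟩ := hbd k hk
    have h1 : IsSubset (column G k) (addNat z k) := by
      intro x hx
      obtain ⟨l, ⟨hl, -⟩, rfl⟩ := mem_column.1 hx
      exact (addNat_mono (hw.ord_of_mem hz) (hGz l hl) k hk).2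
    exact ⟨h1.trans (hw.1.1 _ (haw z k hz hk)),
      hw.fin_or_countablyInfinite_of_subset (haw z k hz hk) h1⟩
  -- The points removed from column `k`. For a column outside the grid the condition is vacuous and
  -- `D k` is the whole column, which is then finite.
  let D : M → M := fun k => sep (column G k) fun x => ∀ s, App f (column G k) s → x ∈ s
  have hDfin : ∀ k, k ∈ (om : M) → IsFin (D k) := by
    intro k hk
    rcases (hcol k hk).2 with h | h
    · exact h.subset fun x hx => (mem_sep.1 hx).1
    · have hmem : column G k ∈ grid w G := mem_grid.2 ⟨(hcol k hk).1, h, Or.inl ⟨k, hk, rfl⟩⟩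
      exact (hfin _ _ (hf.app_ap hmem)).2.subset fun x hx => (mem_sep.1 hx).2 _ (hf.app_ap hmem)
  have hD : ∀ l, l ∈ w → NotSucc l → ∃ k, k ∈ (om : M) ∧ addNat l k ∈ D k := by
    intro l hl hls
    have hmem : row l ∈ grid w G := mem_grid.2 ⟨fun x hx => by
      obtain ⟨k, hk, rfl⟩ := mem_row.1 hx
      exact haw l k hl hk, row_countablyInfinite hls, Or.inr ⟨l, hl, hls, rfl⟩⟩
    -- A finite set contains points of the row `l` only up to some index.
    have hbound : ∀ s : M, IsFin s → ∃ m, m ∈ (om : M) ∧ ∀ k, k ∈ (om : M) → addNat l k ∈ s → k ∈ m := by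
      refine fin_induction _ ⟨emp, emp_mem_om, fun k _ h => absurd h (not_mem_emp _)⟩ ?_
      rintro a s - - ⟨m, hm, hms⟩
      by_cases ha : ∃ k, k ∈ (om : M) ∧ addNat l k = a
      · obtain ⟨k, hk, rfl⟩ := ha
        obtain ⟨m', hm', h1, h2⟩ := exists_nat_ub hm hk
        refine ⟨m', hm', fun j hj h => ?_⟩
        rcases mem_ins.1 h with h | h
        · rwa [(addNat_inj hls hls j hj k hk h).2]
        · exact (isOrd_of_nat hm').trans h1 (hms j hj h)
      · refine ⟨m, hm, fun j hj h => ?_⟩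
        rcases mem_ins.1 h with h | h
        · exact absurd ⟨j, hj, h⟩ ha
        · exact hms j hj h
    obtain ⟨m, hm, hms⟩ := hbound _ (hfin _ _ (hf.app_ap hmem)).2
    obtain ⟨k0, hk0, hlk0⟩ := hcov l hl
    -- Beyond `m` nothing is removed from the row, and beyond `k0` the row meets column `k`; so `l +
    -- k` must be removed from the column.
    obtain ⟨k, hk, hmk, hk0k⟩ := exists_nat_ub hm hk0
    have hout : ¬ addNat l k ∈ ap f (row l) := fun h => not_mem_of_mem hmk (hms k hk h)
    have hlc : addNat l k ∈ column G k :=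
      mem_column.2 ⟨l, ⟨hmono _ _ ((isOrd_of_nat hk).1 _ hk0k) _ hlk0, hls⟩, rfl⟩
    have hlr : addNat l k ∈ row l := mem_row.2 ⟨k, hk, rfl⟩
    refine ⟨k, hk, mem_sep.2 ⟨hlc, fun s hs => ?_⟩⟩
    by_contra hxs
    refine hdisj (row l) (column G k) _ s (fun he => ?_) (hf.app_ap hmem) hs
      ⟨addNat l k, ⟨hlr, hout⟩, hlc, hxs⟩
    -- The row differs from the column: it contains `l + (k + 1)`, while column `k` has only points
    -- with second coordinate `k`.
    have h1 : addNat l (suc k) ∈ column G k := he ▸ mem_row.2 ⟨suc k, suc_mem_om hk, rfl⟩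
    obtain ⟨l', ⟨-, hl'⟩, h2⟩ := mem_column.1 h1
    have h3 := (addNat_inj hls hl' _ (suc_mem_om hk) k hk h2).2
    have h4 : k ∈ suc k := mem_suc.2 (Or.inl rfl)
    rw [h3] at h4
    exact not_mem_self k h4
  let base : M → M := fun y => the fun l => NotSucc l ∧ ∃ j, j ∈ (om : M) ∧ y = addNat l j
  have hbase : ∀ l k, NotSucc l → k ∈ (om : M) → base (addNat l k) = l := fun l k hl hk =>
    the_eq ⟨hl, k, hk, rfl⟩ fun l' ⟨hl', j, hj, h⟩ => (addNat_inj hl hl' k hk j hj h).1.symm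
  have hbD : DFun base := inferInstance
  have hDD : DFun D := inferInstance
  -- The `m`-th set consists of the `base y + k` with `k < m` and `y ∈ D j` for some `j < m`; it is
  -- finite, and these sets exhaust `ω₁`.
  refine hw.not_cover (fun m => bUn m fun k => repl (bUn m fun j => D j) fun y => addNat (base y) k)
    (fun m hm => ?_) fun x hx => ?_
  · exact (isFin_nat hm).bUn _ fun k _ => IsFin.repl ((isFin_nat hm).bUn _ fun j hj =>
      hDfin j (isOrd_om.trans hm hj)) _
  · obtain ⟨l, k, hls, hlx, hlo, hk, rfl⟩ := exists_addNat x (hw.ord_of_mem hx)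
    obtain ⟨j, hj, hlj⟩ := hD l (hw.mem_of_subset hlo hx hlx) hls
    obtain ⟨m, hm, hkm, hjm⟩ := exists_nat_ub hk hj
    refine ⟨m, hm, mem_bUn.2 ⟨k, hkm, mem_repl.2 ⟨addNat l j, mem_bUn.2 ⟨j, hjm, hlj⟩, ?_⟩⟩⟩
    rw [hbase l j hls hj]

theorem isCf_of_MED {w n : M} (hw : IsOmega1 w) (hn : IsTwo n) (h : MED w n) : IsCf w w := by
  refine ⟨hw.1, ?_, ?_⟩
  · obtain ⟨f, hf, hfa⟩ := exists_fun (fun x => x) w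
    refine ⟨f, ⟨hf, fun x y hxy => ?_⟩, fun x hx => ⟨x, x, (hfa _ _).2 ⟨hx, rfl⟩, Or.inr rfl⟩⟩
    obtain ⟨hx, rfl⟩ := (hfa _ _).1 hxy
    exact hx
  · rintro c hc ⟨g, ⟨hg, hgw⟩, hcof⟩
    obtain ⟨E, _, hE1, hE2, hE3, hE4⟩ := exists_cover (hw.2.2 c hc)
    -- Each `G k` is a union of finitely many ordinals below `ω₁`, hence bounded.
    refine grid_not_essentiallyDisjoint hw (fun k => bUn (E k) fun y => ap g y) ?_ ?_ ?_
      (h _ (fun A hA => ?_) (grid_almostDisjoint hn _))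
    · intro j k hjk x hx
      obtain ⟨y, hy, hxy⟩ := mem_bUn.1 hx
      exact mem_bUn.2 ⟨y, hE3 j k hjk y hy, hxy⟩
    · intro k hk
      obtain ⟨z, hz, hzb⟩ := hw.exists_ub_of_fin ((hE1 k hk).repl fun y => ap g y) fun y hy => by
        obtain ⟨x, hx, rfl⟩ := mem_repl.1 hy
        exact ⟨_, hgw _ _ (hg.app_ap (hE2 k x hx)), fun _ h => h⟩
      refine ⟨z, hz, fun x hx => ?_⟩
      obtain ⟨y, hy, hxy⟩ := mem_bUn.1 hx
      exact hzb _ (mem_repl.2 ⟨y, hy, rfl⟩) x hxy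
    · intro x hx
      -- Cofinality is used at `suc x` to get `x ∈ z` strictly.
      obtain ⟨y, z, hyz, hxz⟩ := hcof (suc x) (hw.suc_mem hx)
      obtain ⟨k, hk, hyk⟩ := hE4 y (hg.mem_dom hyz)
      refine ⟨k, hk, mem_bUn.2 ⟨y, hyk, ?_⟩⟩
      rw [hg.ap_eq hyz]
      rcases hxz with h1 | rfl
      · exact (hw.ord_of_mem (hgw _ _ hyz)).trans h1 (mem_suc.2 (Or.inl rfl))
      · exact mem_suc.2 (Or.inl rfl)
    · exact ⟨(mem_grid.1 hA).1, (mem_grid.1 hA).2.1⟩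

end Singular

/-! ### Finite approximations from a uniform denumeration, and regularity. -/

section Denumeration

variable [hM : Fact (ModelsZF M)]

/-- The set of the values of the function `f(b)` at the elements of `k`. -/
noncomputable def seg (f b k : M) : M := sep b fun x => ∃ i, i ∈ k ∧ x = ap (ap f b) i

instance {a b c : (ℕ → M) → M} [Tm a] [Tm b] [Tm c] : Tm (fun g => seg (a g) (b g) (c g)) := by
  unfold seg; infer_instance

theorem mem_seg {f b k x : M} : x ∈ seg f b k ↔ x ∈ b ∧ ∃ i, i ∈ k ∧ x = ap (ap f b) i := by
  rw [seg, mem_sep]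

theorem isFin_seg (f b : M) {k : M} (hk : k ∈ (om : M)) : IsFin (seg f b k) :=
  ((isFin_nat hk).repl fun i => ap (ap f b) i).subset fun _ hx => mem_repl.2 (mem_seg.1 hx).2

theorem seg_mono (f b : M) {j k : M} (h : IsSubset j k) : IsSubset (seg f b j) (seg f b k) := by
  intro x hx
  obtain ⟨h1, i, hi, h2⟩ := mem_seg.1 hx
  exact mem_seg.2 ⟨h1, i, h i hi, h2⟩

theorem IsUniformDenumeration.exists_mem_seg {f w b x : M} (hf : IsUniformDenumeration f w)
    (hb : b ∈ w) (hx : x ∈ b) : ∃ k, k ∈ (om : M) ∧ x ∈ seg f b k := by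
  obtain ⟨g, o, hg, ho, ⟨⟨hgo, -⟩, hsurj⟩⟩ := hf.2 b hb fun h => h x hx
  rw [isOmega_eq] at ho
  subst ho
  obtain ⟨i, hi⟩ := hsurj x hx
  have him := hgo.mem_dom hi
  refine ⟨suc i, suc_mem_om him, mem_seg.2 ⟨hx, i, mem_suc.2 (Or.inl rfl), ?_⟩⟩
  rw [hf.1.ap_eq hg, hgo.ap_eq hi]

/-- Finite subsets of `b` are covered by some `seg f b k`. -/
theorem IsUniformDenumeration.exists_subset_seg {f w b s : M} (hf : IsUniformDenumeration f w)
    (hb : b ∈ w) (hs : IsFin s) (hsb : IsSubset s b) :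
    ∃ k, k ∈ (om : M) ∧ IsSubset s (seg f b k) := by
  obtain ⟨c, ⟨k, hk, rfl⟩, hsc⟩ := hs.subset_directed (fun c => ∃ k, k ∈ (om : M) ∧ c = seg f b k)
    ⟨_, emp, emp_mem_om, rfl⟩ (by
      rintro _ _ ⟨j, hj, rfl⟩ ⟨k, hk, rfl⟩
      obtain ⟨m, hm, hjm, hkm⟩ := exists_nat_ub hj hk
      exact ⟨_, ⟨m, hm, rfl⟩, seg_mono f b ((isOrd_of_nat hm).1 _ hjm),
        seg_mono f b ((isOrd_of_nat hm).1 _ hkm)⟩) (by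
      intro x hx
      obtain ⟨k, hk, hxk⟩ := hf.exists_mem_seg hb (hsb x hx)
      exact ⟨_, ⟨k, hk, rfl⟩, hxk⟩)
  exact ⟨k, hk, hsc⟩

/-- A uniform denumeration makes `ω₁` regular. -/
theorem IsUniformDenumeration.exists_ub {f w : M} (hf : IsUniformDenumeration f w)
    (hw : IsOmega1 w) (H : M → M) [DFun H] (hH : ∀ k, k ∈ (om : M) → H k ∈ w) :
    ∃ d, d ∈ w ∧ ∀ k, k ∈ (om : M) → IsSubset (H k) d := by
  by_contra! h
  -- If the `H i` were unbounded, their simultaneous finite approximations would cover `ω₁`.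
  refine hw.not_cover (fun k => bUn k fun i => seg f (H i) k) (fun k hk =>
    (isFin_nat hk).bUn _ fun i _ => isFin_seg f (H i) hk) fun x hx => ?_
  obtain ⟨i, hi, hix⟩ := h _ (hw.suc_mem hx)
  have hxH : x ∈ H i := by
    rcases (hw.ord_of_mem (hH i hi)).subset_or_mem (hw.ord_of_mem (hw.suc_mem hx)) with h1 | h1
    · exact absurd h1 hix
    · exact (hw.ord_of_mem (hH i hi)).trans h1 (mem_suc.2 (Or.inl rfl))
  obtain ⟨j, hj, hxj⟩ := hf.exists_mem_seg (hH i hi) hxH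
  obtain ⟨m, hm, him, hjm⟩ := exists_nat_ub hi hj
  exact ⟨m, hm, mem_bUn.2 ⟨i, him, seg_mono f _ ((isOrd_of_nat hm).1 _ hjm) x hxj⟩⟩

end Denumeration

/-! ### Closed ordinals, levels and stages; essential disjointness. -/

section AlmostDisjointFamilies

variable [hM : Fact (ModelsZF M)]

/-- `X` has a subset with exactly `n` elements. -/
def HasSub (n X : M) : Prop := ∃ s, IsSubset s X ∧ Equinum s n

instance {a b : (ℕ → M) → M} [Tm a] [Tm b] : Dfn (fun g => HasSub (a g) (b g)) := by
  unfold HasSub; infer_instance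

omit hM in
theorem HasSub.mono {n X Y : M} (h : HasSub n X) (hXY : IsSubset X Y) : HasSub n Y := by
  obtain ⟨s, hs, he⟩ := h
  exact ⟨s, hs.trans hXY, he⟩

theorem AlmostDisjoint.isFin_int {n F A B : M} (h : AlmostDisjoint n F) (hn : n ∈ (om : M))
    (hA : A ∈ F) (hB : B ∈ F) (hne : A ≠ B) : IsFin (int A B) := by
  obtain ⟨c, hc, m, hm, he⟩ := h A B hA hB hne
  rw [← isInter_eq.1 hc]
  exact isFin_iff.2 ⟨m, isOrd_om.trans hn hm, he⟩

/-- If `A ≠ B`, the `n` points of `s` would lie in an intersection of fewer than `n` points. -/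
theorem AlmostDisjoint.eq_of_subset {n F A B s : M} (h : AlmostDisjoint n F) (hn : n ∈ (om : M))
    (hA : A ∈ F) (hB : B ∈ F) (hs : Equinum s n) (hsA : IsSubset s A) (hsB : IsSubset s B) :
    A = B := by
  by_contra hne
  obtain ⟨c, hc, m, hm, he⟩ := h A B hA hB hne
  have hmo := isOrd_om.trans hn hm
  have h1 := card_mono (isFin_iff.2 ⟨m, hmo, he⟩) (s := s) fun x hx => (hc x).2 ⟨hsA x hx, hsB x hx⟩
  rw [card_eq hn hs, card_eq hmo he] at h1
  exact not_mem_self m (h1 m hm)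

/-- Only finitely many members of an almost disjoint family meet a finite set in `n` points. -/
theorem AlmostDisjoint.isFin_hasSub {n F S : M} (h : AlmostDisjoint n F) (hn : n ∈ (om : M))
    (hS : IsFin S) : IsFin (sep F fun A => HasSub n (int A S)) := by
  -- Each of the finitely many subsets of `S` of size `n` lies in at most one member.
  refine (hS.pow.bUn (fun s => sep F fun A => IsSubset s A ∧ Equinum s n) fun s _ => ?_).subset
    fun A hA => ?_
  · by_cases h0 : (sep F fun A => IsSubset s A ∧ Equinum s n) = emp
    · rw [h0]
      exact isFin_emp
    · obtain ⟨A, hA⟩ := exists_mem_of_ne h0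
      refine (isFin_singleton A).subset fun B hB => mem_ins.2 (Or.inl ?_)
      rw [mem_sep] at hA hB
      exact h.eq_of_subset hn hB.1 hA.1 hA.2.2 hB.2.1 hA.2.1
  · obtain ⟨hAF, s, hs, he⟩ := mem_sep.1 hA
    exact mem_bUn.2 ⟨s, mem_pow.2 fun x hx => (mem_int.1 (hs x hx)).2,
      mem_sep.2 ⟨hAF, fun x hx => (mem_int.1 (hs x hx)).1, he⟩⟩

/-- The ordinal `d < ω₁` includes each member of `F` that it meets in `n` points. -/
def IsClosedFor (n F w d : M) : Prop := d ∈ w ∧ ∀ A, A ∈ F → HasSub n (int A d) → IsSubset A d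

instance {a b c d : (ℕ → M) → M} [Tm a] [Tm b] [Tm c] [Tm d] :
    Dfn (fun g => IsClosedFor (a g) (b g) (c g) (d g)) := by
  unfold IsClosedFor; infer_instance

variable {n F w f : M}

theorem exists_ub_of_countable (hw : IsOmega1 w) (hf : IsUniformDenumeration f w) {A : M}
    (hAw : IsSubset A w) (hA : IsCountablyInfinite A) : ∃ d, d ∈ w ∧ IsSubset A d := by
  obtain ⟨H, _, h1, -, h3⟩ := (isCountablyInfinite_iff.1 hA).symm.exists_fun
  obtain ⟨d, hd, hHd⟩ := hf.exists_ub hw (fun k => suc (H k)) fun k hk =>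
    hw.suc_mem (hAw _ (h1 k hk))
  refine ⟨d, hd, fun x hx => ?_⟩
  obtain ⟨k, hk, rfl⟩ := h3 x hx
  exact hHd k hk _ (mem_suc.2 (Or.inl rfl))

/-- Any `n` points of `b` lie in some `seg f b k`. For each `k` finitely many members are involved,
so they have a least common bound, and regularity bounds these over `k`. -/
theorem exists_ub_of_meets (hw : IsOmega1 w) (hf : IsUniformDenumeration f w) (hn : n ∈ (om : M))
    (hF : ∀ A, A ∈ F → IsSubset A w ∧ IsCountablyInfinite A) (had : AlmostDisjoint n F) {b : M}
    (hb : b ∈ w) : ∃ d, d ∈ w ∧ IsSubset b d ∧ ∀ A, A ∈ F → HasSub n (int A b) → IsSubset A d := by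
  have h1 : ∀ k, k ∈ (om : M) → ∃ d, d ∈ w ∧
      ∀ A, A ∈ F → HasSub n (int A (seg f b k)) → IsSubset A d := by
    intro k hk
    obtain ⟨d, hd, hAd⟩ := hw.exists_ub_of_fin (had.isFin_hasSub hn (isFin_seg f b hk))
      fun A hA => exists_ub_of_countable hw hf (hF A (mem_sep.1 hA).1).1 (hF A (mem_sep.1 hA).1).2
    exact ⟨d, hd, fun A hA h => hAd A (mem_sep.2 ⟨hA, h⟩)⟩
  have h2 : ∀ k, k ∈ (om : M) → (least fun d => d ∈ w ∧
      ∀ A, A ∈ F → HasSub n (int A (seg f b k)) → IsSubset A d) ∈ w ∧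
      ∀ A, A ∈ F → HasSub n (int A (seg f b k)) → IsSubset A (least fun d => d ∈ w ∧
        ∀ A, A ∈ F → HasSub n (int A (seg f b k)) → IsSubset A d) := by
    intro k hk
    obtain ⟨d, hd⟩ := h1 k hk
    exact (least_spec (fun d => d ∈ w ∧
      ∀ A, A ∈ F → HasSub n (int A (seg f b k)) → IsSubset A d) (hw.ord_of_mem hd.1) hd).2.1
  obtain ⟨d, hd, hHd⟩ := hf.exists_ub hw _ fun k hk => (h2 k hk).1
  obtain ⟨e, he, hbe, hde⟩ := hw.exists_ub hb hd
  refine ⟨e, he, hbe, fun A hA ⟨s, hs, hsn⟩ => ?_⟩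
  obtain ⟨k, hk, hsk⟩ := hf.exists_subset_seg hb (isFin_iff.2 ⟨n, hn, hsn⟩)
    fun x hx => (mem_int.1 (hs x hx)).2
  exact (((h2 k hk).2 A hA ⟨s, fun x hx => mem_int.2 ⟨(mem_int.1 (hs x hx)).1, hsk x hx⟩, hsn⟩).trans
    (hHd k hk)).trans hde

/-- Iterate the previous bound `ω` times and take the supremum: any `n` points below it already lie
in one iterate, so the next iterate includes the member. -/
theorem exists_isClosedFor (hw : IsOmega1 w) (hf : IsUniformDenumeration f w) (hn : n ∈ (om : M))
    (hF : ∀ A, A ∈ F → IsSubset A w ∧ IsCountablyInfinite A) (had : AlmostDisjoint n F) {a : M}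
    (ha : a ∈ w) : ∃ d, IsClosedFor n F w d ∧ IsSubset a d := by
  let N : M → M := fun b => least fun d => d ∈ w ∧ IsSubset b d ∧
    ∀ A, A ∈ F → HasSub n (int A b) → IsSubset A d
  have hND : DFun N := inferInstance
  have hN : ∀ b, b ∈ w → N b ∈ w ∧ IsSubset b (N b) ∧
      ∀ A, A ∈ F → HasSub n (int A b) → IsSubset A (N b) := by
    intro b hb
    obtain ⟨d, hd⟩ := exists_ub_of_meets hw hf hn hF had hb
    exact (least_spec (fun d => d ∈ w ∧ IsSubset b d ∧
      ∀ A, A ∈ F → HasSub n (int A b) → IsSubset A d) (hw.ord_of_mem hd.1) hd).2.1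
  have hI : ∀ k, k ∈ (om : M) → iter N a k ∈ w := iter_mem N ha fun b hb => (hN b hb).1
  have hIs : ∀ k, k ∈ (om : M) → IsSubset (iter N a k) (iter N a (suc k)) := by
    intro k hk
    rw [iter_suc N a hk]
    exact (hN _ (hI k hk)).2.1
  have hmono : ∀ k, k ∈ (om : M) → ∀ j, j ∈ k → IsSubset (iter N a j) (iter N a k) := by
    refine nat_induction _ (fun j hj => absurd hj (not_mem_emp j)) ?_
    intro k hk ih j hj
    rcases mem_suc.1 hj with rfl | hj
    · exact hIs _ hk
    · exact (ih j hj).trans (hIs k hk)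
  obtain ⟨u, hu, hIu⟩ := hf.exists_ub hw (fun k => iter N a k) hI
  obtain ⟨h1, h2, h3, -⟩ := least_spec (fun d => d ∈ w ∧ ∀ k, k ∈ (om : M) → IsSubset (iter N a k) d)
    (hw.ord_of_mem hu) ⟨hu, hIu⟩
  generalize (least fun d => d ∈ w ∧ ∀ k, k ∈ (om : M) → IsSubset (iter N a k) d) = d at h1 h2 h3
  -- A point of `d` outside every iterate would be a smaller upper bound.
  have hcov : ∀ x, x ∈ d → ∃ k, k ∈ (om : M) ∧ x ∈ iter N a k := by
    intro x hx
    by_contra! h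
    refine h3 x hx ⟨hw.1.trans h2.1 hx, fun k hk => ?_⟩
    rcases (hw.ord_of_mem (hI k hk)).subset_or_mem (h1.of_mem hx) with h4 | h4
    · exact h4
    · exact absurd h4 (h k hk)
  refine ⟨d, ⟨h2.1, fun A hA ⟨s, hs, hsn⟩ => ?_⟩, ?_⟩
  · obtain ⟨b, ⟨k, hk, rfl⟩, hsb⟩ := (isFin_iff.2 ⟨n, hn, hsn⟩ : IsFin s).subset_directed
      (fun b => ∃ k, k ∈ (om : M) ∧ b = iter N a k) ⟨_, emp, emp_mem_om, rfl⟩ (by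
        rintro _ _ ⟨j, hj, rfl⟩ ⟨k, hk, rfl⟩
        obtain ⟨m, hm, hjm, hkm⟩ := exists_nat_ub hj hk
        exact ⟨_, ⟨m, hm, rfl⟩, hmono m hm j hjm, hmono m hm k hkm⟩) (by
        intro x hx
        obtain ⟨k, hk, hxk⟩ := hcov x (mem_int.1 (hs x hx)).2
        exact ⟨_, ⟨k, hk, rfl⟩, hxk⟩)
    have h4 := (hN _ (hI k hk)).2.2 A hA
      ⟨s, fun x hx => mem_int.2 ⟨(mem_int.1 (hs x hx)).1, hsb x hx⟩, hsn⟩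
    rw [← iter_suc N a hk] at h4
    exact h4.trans (h2.2 _ (suc_mem_om hk))
  · have h4 := h2.2 emp emp_mem_om
    rwa [iter_zero] at h4

/-- The least closed ordinal that includes `A`. -/
noncomputable def level (n F w A : M) : M := least fun d => IsClosedFor n F w d ∧ IsSubset A d

instance {a b c d : (ℕ → M) → M} [Tm a] [Tm b] [Tm c] [Tm d] :
    Tm (fun g => level (a g) (b g) (c g) (d g)) := by
  unfold level; infer_instance

/-- The least `k` such that `A` meets the first `k` elements of its level in `n` points. -/
noncomputable def stage (n F w f A : M) : M :=
  least fun k => k ∈ (om : M) ∧ HasSub n (int A (seg f (level n F w A) k))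

instance {a b c d e : (ℕ → M) → M} [Tm a] [Tm b] [Tm c] [Tm d] [Tm e] :
    Tm (fun g => stage (a g) (b g) (c g) (d g) (e g)) := by
  unfold stage; infer_instance

/-- The points of `A` that belong to other members of `F` of no higher level and stage. -/
noncomputable def excess (n F w f A : M) : M := sep A fun x => ∃ B, B ∈ F ∧ B ≠ A ∧ x ∈ B ∧
  (level n F w B ∈ level n F w A ∨
    (level n F w B = level n F w A ∧ IsSubset (stage n F w f B) (stage n F w f A)))

instance {a b c d e : (ℕ → M) → M} [Tm a] [Tm b] [Tm c] [Tm d] [Tm e] :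
    Tm (fun g => excess (a g) (b g) (c g) (d g) (e g)) := by
  unfold excess; infer_instance

/-- The last clause is leastness: a smaller closed ordinal meeting `A` in `n` points would already
include `A`. -/
theorem level_spec (hw : IsOmega1 w) (hf : IsUniformDenumeration f w) (hn : n ∈ (om : M))
    (hF : ∀ A, A ∈ F → IsSubset A w ∧ IsCountablyInfinite A) (had : AlmostDisjoint n F) {A : M}
    (hA : A ∈ F) : IsClosedFor n F w (level n F w A) ∧ IsSubset A (level n F w A) ∧
      ∀ d, d ∈ level n F w A → IsClosedFor n F w d → ¬ HasSub n (int A d) := by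
  obtain ⟨b, hb, hAb⟩ := exists_ub_of_countable hw hf (hF A hA).1 (hF A hA).2
  obtain ⟨d, hd, hbd⟩ := exists_isClosedFor hw hf hn hF had hb
  obtain ⟨-, h2, h3, -⟩ := least_spec (fun d => IsClosedFor n F w d ∧ IsSubset A d)
    (hw.ord_of_mem hd.1) ⟨hd, hAb.trans hbd⟩
  exact ⟨h2.1, h2.2, fun c hc hcc hs => h3 c hc ⟨hcc, hcc.2 A hA hs⟩⟩

theorem stage_spec (hw : IsOmega1 w) (hf : IsUniformDenumeration f w) (hn : n ∈ (om : M))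
    (hF : ∀ A, A ∈ F → IsSubset A w ∧ IsCountablyInfinite A) (had : AlmostDisjoint n F) {A : M}
    (hA : A ∈ F) : stage n F w f A ∈ (om : M) ∧
      HasSub n (int A (seg f (level n F w A) (stage n F w f A))) := by
  obtain ⟨h1, h2, -⟩ := level_spec hw hf hn hF had hA
  obtain ⟨s, hs, hsn⟩ := exists_subset_card (hF A hA).2.not_isFin hn
  obtain ⟨k, hk, hsk⟩ := hf.exists_subset_seg h1.1 (isFin_iff.2 ⟨n, hn, hsn⟩) (hs.trans h2)
  exact (least_spec (fun k => k ∈ (om : M) ∧ HasSub n (int A (seg f (level n F w A) k)))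
    (isOrd_of_nat hk) ⟨hk, s, fun x hx => mem_int.2 ⟨hs x hx, hsk x hx⟩, hsn⟩).2.1

theorem isFin_excess (hw : IsOmega1 w) (hf : IsUniformDenumeration f w) (hn : n ∈ (om : M))
    (hF : ∀ A, A ∈ F → IsSubset A w ∧ IsCountablyInfinite A) (had : AlmostDisjoint n F) {A : M}
    (hA : A ∈ F) : IsFin (excess n F w f A) := by
  obtain ⟨h1, h2, h3⟩ := level_spec hw hf hn hF had hA
  -- This contains the points shared with members of lower level. Closed ordinals form a chain, so
  -- `n` such points would lie in a single one, against `level_spec`.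
  have hlow : IsFin (sep A fun x => ∃ d, (d ∈ level n F w A ∧ IsClosedFor n F w d) ∧ x ∈ d) := by
    by_contra hinf
    obtain ⟨s, hs, hsn⟩ := exists_subset_card hinf hn
    -- Directedness needs at least one closed ordinal; a point of an infinite set supplies it even
    -- when `n` is zero.
    have hne : ∃ x, x ∈ sep A fun x => ∃ d, (d ∈ level n F w A ∧ IsClosedFor n F w d) ∧ x ∈ d := by
      by_contra! h
      exact hinf (eq_emp h ▸ isFin_emp)
    obtain ⟨d, ⟨hd, hdc⟩, hsd⟩ := (isFin_iff.2 ⟨n, hn, hsn⟩ : IsFin s).subset_directed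
      (fun d => d ∈ level n F w A ∧ IsClosedFor n F w d) (by
        obtain ⟨x, hx⟩ := hne
        obtain ⟨-, d, hd, -⟩ := mem_sep.1 hx
        exact ⟨d, hd⟩) (by
        intro b c hb hc
        rcases (hw.ord_of_mem hb.2.1).subset_or_mem (hw.ord_of_mem hc.2.1) with h | h
        · exact ⟨c, hc, h, fun _ h => h⟩
        · exact ⟨b, hb, fun _ h => h, (hw.ord_of_mem hb.2.1).1 c h⟩)
      fun x hx => (mem_sep.1 (hs x hx)).2
    exact h3 d hd hdc ⟨s, fun x hx => mem_int.2 ⟨(mem_sep.1 (hs x hx)).1, hsd x hx⟩, hsn⟩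
  -- Members of the same level and no larger stage meet this one finite segment in `n` points, so
  -- there are finitely many, each with finite intersection with `A`.
  have hsame : IsFin (bUn (sep (sep F fun B => HasSub n (int B
      (seg f (level n F w A) (stage n F w f A)))) fun B => B ≠ A) fun B => int B A) := by
    refine IsFin.bUn ((had.isFin_hasSub hn (isFin_seg f _
      (stage_spec hw hf hn hF had hA).1)).subset fun B hB => (mem_sep.1 hB).1) _ fun B hB => ?_
    obtain ⟨hB, hne⟩ := mem_sep.1 hB
    exact had.isFin_int hn (mem_sep.1 hB).1 hA hne
  refine (hlow.un hsame).subset fun x hx => ?_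
  rw [excess, mem_sep] at hx
  obtain ⟨hxA, B, hB, hne, hxB, h | ⟨h, h'⟩⟩ := hx
  · obtain ⟨h4, h5, -⟩ := level_spec hw hf hn hF had hB
    exact mem_un.2 (Or.inl (mem_sep.2 ⟨hxA, _, ⟨h, h4⟩, h5 x hxB⟩))
  · refine mem_un.2 (Or.inr (mem_bUn.2 ⟨B, mem_sep.2 ⟨mem_sep.2 ⟨hB, ?_⟩, hne⟩,
      mem_int.2 ⟨hxB, hxA⟩⟩))
    have h4 := (stage_spec hw hf hn hF had hB).2
    rw [h] at h4
    exact h4.mono fun y hy => mem_int.2 ⟨(mem_int.1 hy).1, seg_mono f _ h' y (mem_int.1 hy).2⟩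

theorem MED_of_isUniformDenumeration (hw : IsOmega1 w) (hf : IsUniformDenumeration f w)
    (hn : n ∈ (om : M)) : MED w n := by
  intro F hF had
  obtain ⟨e, he, hea⟩ := exists_fun (fun A => excess n F w f A) F
  refine ⟨e, he, fun A s hs => ?_, fun A B s t hne hs ht => ?_⟩
  · obtain ⟨hA, rfl⟩ := (hea _ _).1 hs
    exact ⟨fun x hx => by rw [excess, mem_sep] at hx; exact hx.1, isFin_excess hw hf hn hF had hA⟩
  · obtain ⟨hA, rfl⟩ := (hea _ _).1 hs
    obtain ⟨hB, rfl⟩ := (hea _ _).1 ht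
    rintro ⟨x, ⟨hxA, hxs⟩, hxB, hxt⟩
    rw [excess, mem_sep] at hxs hxt
    have hlA := hw.ord_of_mem (level_spec hw hf hn hF had hA).1.1
    have hlB := hw.ord_of_mem (level_spec hw hf hn hF had hB).1.1
    -- A common point is in the excess of whichever member is not lower; on a tie it is in both, so
    -- either choice does.
    rcases hlA.trichotomy hlB with h | h | h
    · exact hxt ⟨hxB, A, hA, hne, hxA, Or.inl h⟩
    · rcases nat_subset_or_mem (stage_spec hw hf hn hF had hA).1
        (stage_spec hw hf hn hF had hB).1 with h' | h'
      · exact hxt ⟨hxB, A, hA, hne, hxA, Or.inr ⟨h, h'⟩⟩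
      · exact hxs ⟨hxA, B, hB, hne.symm, hxB, Or.inr ⟨h.symm,
          (isOrd_of_nat (stage_spec hw hf hn hF had hA).1).1 _ h'⟩⟩
    · exact hxs ⟨hxA, B, hB, hne.symm, hxB, Or.inl h⟩

end AlmostDisjointFamilies

end ZFModel

theorem mainTheorem4 {M : Type*} [Membership M M] (hM : ZFModel.ModelsZF M) :
    (ZFModel.UDOmega1 M → ∀ n : M, ZFModel.IsNat n → ZFModel.MEDOmega1 n) ∧
    ((∃ n : M, ZFModel.IsTwo n ∧ ZFModel.MEDOmega1 n) → ZFModel.CfOmega1 M) := by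
  have : Fact (ZFModel.ModelsZF M) := ⟨hM⟩
  constructor
  · rintro ⟨w, hw, f, hf⟩ n hn
    exact ⟨w, hw, ZFModel.MED_of_isUniformDenumeration hw hf (ZFModel.isNat_iff.1 hn)⟩
  · rintro ⟨n, hn, w, hw, h⟩
    exact ⟨w, hw, ZFModel.isCf_of_MED hw hn h⟩
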